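/- For $1\le k\le d$ let $\mathbb S_{d,k}=\{E\in\mathbb R^{d\times k}:E^\top E=I_k\}$, and for $E\in\mathbb S_{d,k}$ let $E^\star_\#\mu$ be the push-forward of a Borel probability measure $\mu$ on $\mathbb R^d$ under $x\mapsto E^\top x$. With $\|\cdot\|$ the Euclidean norm, let $\mathcal W_p(\mu,\nu)=\bigl(\inf_{\pi}\int\|x-y\|^p\,d\pi(x,y)\bigr)^{1/p}$ (infimum over all couplings $\pi$ of $\mu$ and $\nu$) be the Wasserstein distance of order $p$, let $\overline{\mathcal{PW}}_{p,k}(\mu,\nu)=\sup_{E\in\mathbb S_{d,k}}\mathcal W_p(E^\star_\#\mu,E^\star_\#\nu)$, and let $M_q(\mu)=\int\|x\|^q\,d\mu(x)$. The measure $\mu$ satisfies the projection Bernstein tail condition with constants $\sigma,V>0$ if, for all $E\in\mathbb S_{d,k}$ and all integers $r\ge2$, $\mathbb E\|X\|^r\le\frac12\sigma^2\,r!\,V^{r-2}$ where $X\sim E^\star_\#\mu$. Put $$\zeta_{p,q,k}=\begin{cases}2&\text{if }k=q=2p,\\ 1&\text{if }\bigl(k\ne2p\text{ and }q=\tfrac{kp}{k-p}\bigr)\text{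 or }q>k=2p,\\ 0&\text{otherwise.}\end{cases}$$ **Theorem.** For all real $q\ge p\ge1$ there is a constant $C>0$, depending only on $(p,q)$, such that the following holds. Let $1\le k\le d$ be integers, and let $\mu_\star$ be a Borel probability measure on $\mathbb R^d$ with $M_q(\mu_\star)<\infty$ that satisfies the projection Bernstein tail condition with constants $\sigma,V>0$. Let $n\ge2$, or let $n=1$ and $\zeta_{p,q,k}=0$ (with $0^0=1$). If $X_1,\dots,X_n$ are i.i.d. with law $\mu_\star$ and $\widehat\mu_n=\frac1n\sum_{i=1}^n\delta_{X_i}$, then $$\mathbb E\bigl[\overline{\mathcal{PW}}_{p,k}(\widehat\mu_n,\mu_\star)\bigr]\le C\,\bigl(M_q(\mu_\star)^{1/q}+\sigma+V\bigr)\Bigl(n^{-\left[\frac1{(2p)\vee k}\wedge\left(\frac1p-\frac1q\right)\right]}(\log n)^{\zeta_{p,q,k}/p}+n^{\frac12-\frac1p}\sqrt{dk\log n}+n^{-\frac1p}\,dk\log n\Bigr).$$ -/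

import Mathlib

open MeasureTheory ProbabilityTheory
open scoped ENNReal Nat

noncomputable section

namespace PRW

/-- The Stiefel manifold of real `d × k` matrices `E` with `Eᵀ E = I_k`. -/
def stiefel (d k : ℕ) : Set (Matrix (Fin d) (Fin k) ℝ) :=
  {E | E.transpose * E = 1}

/-- The linear map `x ↦ Eᵀ x` from `ℝ^d` to `ℝ^k`, both with the Euclidean norm. -/
def proj {d k : ℕ} (E : Matrix (Fin d) (Fin k) ℝ) (x : EuclideanSpace ℝ (Fin d)) :
    EuclideanSpace ℝ (Fin k) :=
  WithLp.toLp 2 (E.transpose.mulVec x.ofLp)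

theorem continuous_proj {d k : ℕ} (E : Matrix (Fin d) (Fin k) ℝ) : Continuous (proj E) := by
  unfold proj
  fun_prop

theorem measurable_proj {d k : ℕ} (E : Matrix (Fin d) (Fin k) ℝ) : Measurable (proj E) :=
  (continuous_proj E).measurable

/-- `M_q(μ) = ∫ ‖x‖^q dμ(x)`, with values in `[0, ∞]`. -/
def absMoment {m : ℕ} (q : ℝ) (μ : Measure (EuclideanSpace ℝ (Fin m))) : ℝ≥0∞ :=
  ∫⁻ x, ‖x‖ₑ ^ q ∂μ

/-- The measures on `ℝ^m × ℝ^m` with marginals `μ` and `ν`. -/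
def couplings {m : ℕ} (μ ν : Measure (EuclideanSpace ℝ (Fin m))) :
    Set (Measure (EuclideanSpace ℝ (Fin m) × EuclideanSpace ℝ (Fin m))) :=
  {π | π.fst = μ ∧ π.snd = ν}

/-- The Wasserstein distance of order `p`, with values in `[0, ∞]`. -/
def wasserstein {m : ℕ} (p : ℝ) (μ ν : Measure (EuclideanSpace ℝ (Fin m))) : ℝ≥0∞ :=
  (⨅ π ∈ couplings μ ν, ∫⁻ z, ‖z.1 - z.2‖ₑ ^ p ∂π) ^ (1 / p)

/-- The projection robust Wasserstein distance of order `p` and projected dimension `k`. -/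
def prw {d : ℕ} (p : ℝ) (k : ℕ) (μ ν : Measure (EuclideanSpace ℝ (Fin d))) : ℝ≥0∞ :=
  ⨆ E ∈ stiefel d k, wasserstein p (μ.map (proj E)) (ν.map (proj E))

/-- The empirical measure `(1/n) ∑ δ_{x_i}` of a sample `x_1, …, x_n`. -/
def empirical {d n : ℕ} (x : Fin n → EuclideanSpace ℝ (Fin d)) :
    Measure (EuclideanSpace ℝ (Fin d)) :=
  (n : ℝ≥0∞)⁻¹ • ∑ i, Measure.dirac (x i)

/-- The projection Bernstein tail condition with constants `σ` and `V` (the same for all `E`):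
`𝔼 ‖X‖^r ≤ (1/2) σ² r! V^(r-2)` for `X` distributed as the image of `μ` under `E`,
for all `E` in the Stiefel manifold and all integers `r ≥ 2`. -/
structure ProjBernsteinTail {d : ℕ} (k : ℕ) (σ V : ℝ)
    (μ : Measure (EuclideanSpace ℝ (Fin d))) : Prop where
  sigma_pos : 0 < σ
  V_pos : 0 < V
  moment_le : ∀ E ∈ stiefel d k, ∀ r : ℕ, 2 ≤ r →
    ∫⁻ y, ‖y‖ₑ ^ r ∂(μ.map (proj E)) ≤ ENNReal.ofReal (1 / 2 * σ ^ 2 * r ! * V ^ (r - 2))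

/-- The exponent `ζ_{p,q,k}` of the logarithm. -/
def zeta (p q : ℝ) (k : ℕ) : ℝ :=
  if (k : ℝ) = 2 * p ∧ q = 2 * p then 2
  else if ((k : ℝ) ≠ 2 * p ∧ q = k * p / (k - p)) ∨ ((k : ℝ) = 2 * p ∧ (k : ℝ) < q) then 1
  else 0

/-- `n^{-[1/((2p) ∨ k) ∧ (1/p - 1/q)]} (log n)^{ζ_{p,q,k}/p}`. -/
def iprwRate (p q : ℝ) (k n : ℕ) : ℝ :=
  (n : ℝ) ^ (-(min (1 / max (2 * p) (k : ℝ)) (1 / p - 1 / q))) *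
    Real.log n ^ (zeta p q k / p)

end PRW

end

noncomputable section

namespace PRW

/-! ### The Wasserstein distance -/

/-! The Bernstein condition gives all projected laws moments of every order `r ≥ 2`, on the scale `σ
+ V` and uniformly in `E`. For a fixed `E` the mean distance to the empirical measure is therefore
of order `n^{-1/((2p) ∨ k)}`, with an extra `(log n)^{1/p}` when `k = 2p`. The order `q` plays no
role there; up to constants the stated rate is weaker, and only the logarithm has to be compared
with `ζ` (`exists_le_iprwRate`). The last two terms of the bound pay for the supremum over `E`.

Mean (`exists_mean_bound`): the space is cut into dyadic shells and each shell into nested dyadic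
cells. Matching mass inside the finest cells and passing the surplus to coarser ones bounds the cost
by a sum over levels of (diameter)^p times the discrepancies of the cell masses
(`exists_coupling_nested`). A discrepancy is at most a standard deviation in the mean,
Cauchy–Schwarz sums over the cells of a shell, and a high moment sums over the shells. The number of
levels is then optimized.

Concentration (`lintegral_exp_sampleDist_le`): replacing one sample point `a` by `b` moves the
distance by at most `n^{-1/p} ‖a - b‖`. A bounded-difference argument, with Bernstein moments in
place of bounded increments, controls the log-Laplace transform at `t` by `t` times the mean plus `4
n t² n^{-2/p} σ²`, provided `4 t n^{-1/p} V ≤ 1`.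

Supremum (`lintegral_prw_empirical_le`): the Stiefel manifold has a `1/n`-net in operator norm of
log-cardinality at most `3 d k log n`. Exponential moments bound the mean of the maximum over the
net, and optimizing `t` gives the terms in `√(d k log n)` and `d k log n`. Passing to the nearest
net point costs at most `2 M_q^{1/q} / n` in the mean, which the rate absorbs. -/

theorem wasserstein_eq_iInf {m : ℕ} {p : ℝ} (hp : 1 ≤ p) (μ ν : Measure (EuclideanSpace ℝ (Fin m))) :
    wasserstein p μ ν = ⨅ π ∈ couplings μ ν, (∫⁻ z, ‖z.1 - z.2‖ₑ ^ p ∂π) ^ (1 / p) := by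
  have h : 0 < 1 / p := by positivity
  exact (ENNReal.orderIsoRpow (1 / p) h).map_iInf₂ _

theorem wasserstein_le_of_coupling {m : ℕ} {p : ℝ} (hp : 1 ≤ p)
    {μ ν : Measure (EuclideanSpace ℝ (Fin m))} {π} (hπ : π ∈ couplings μ ν) :
    wasserstein p μ ν ≤ (∫⁻ z, ‖z.1 - z.2‖ₑ ^ p ∂π) ^ (1 / p) := by
  rw [wasserstein_eq_iInf hp]
  exact iInf₂_le π hπ

theorem wasserstein_map_map_le {m : ℕ} {p : ℝ} (hp : 1 ≤ p) {α : Type*} [MeasurableSpace α]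
    (μ : Measure α) {f g : α → EuclideanSpace ℝ (Fin m)} (hf : Measurable f) (hg : Measurable g) :
    wasserstein p (μ.map f) (μ.map g) ≤ (∫⁻ x, ‖f x - g x‖ₑ ^ p ∂μ) ^ (1 / p) := by
  have hc : μ.map (fun x => (f x, g x)) ∈ couplings (μ.map f) (μ.map g) :=
    ⟨Measure.fst_map_prodMk hg, Measure.snd_map_prodMk hf⟩
  refine (wasserstein_le_of_coupling hp hc).trans_eq ?_
  rw [lintegral_map (by fun_prop) (by fun_prop)]

/-- Gluing of two couplings along their common marginal. -/
theorem exists_gluing {m : ℕ} {μ ν ρ : Measure (EuclideanSpace ℝ (Fin m))} [IsFiniteMeasure μ]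
    [IsFiniteMeasure ν] {π₁ π₂} (h₁ : π₁ ∈ couplings μ ν) (h₂ : π₂ ∈ couplings ν ρ) :
    ∃ γ : Measure ((EuclideanSpace ℝ (Fin m) × EuclideanSpace ℝ (Fin m)) ×
        EuclideanSpace ℝ (Fin m)),
      γ.map Prod.fst = π₁ ∧ γ.map (fun t => (t.1.2, t.2)) = π₂ := by
  have f₁ : IsFiniteMeasure π₁ := ⟨by
    rw [← Measure.fst_univ, h₁.1]; exact measure_lt_top _ _⟩
  have f₂ : IsFiniteMeasure π₂ := ⟨by
    rw [← Measure.fst_univ, h₂.1]; exact measure_lt_top _ _⟩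
  -- Given `(x, y)` drawn from `π₁`, the third coordinate follows the conditional law of `π₂` given
  -- `y`.
  refine ⟨π₁ ⊗ₘ (π₂.condKernel.comap Prod.snd measurable_snd), ?_, ?_⟩
  · exact Measure.fst_compProd π₁ (π₂.condKernel.comap Prod.snd measurable_snd)
  · refine Measure.ext_of_lintegral _ fun f hf => ?_
    rw [lintegral_map hf (by fun_prop), Measure.lintegral_compProd (by fun_prop)]
    simp only [Kernel.comap_apply]
    conv_rhs => rw [← π₂.disintegrate π₂.condKernel, Measure.lintegral_compProd hf, h₂.1, ← h₁.2]
    rw [Measure.snd, lintegral_map _ measurable_snd]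
    exact hf.lintegral_kernel_prod_right'

theorem wasserstein_triangle {m : ℕ} {p : ℝ} (hp : 1 ≤ p)
    (μ ν ρ : Measure (EuclideanSpace ℝ (Fin m))) [IsFiniteMeasure μ] [IsFiniteMeasure ν] :
    wasserstein p μ ρ ≤ wasserstein p μ ν + wasserstein p ν ρ := by
  rw [wasserstein_eq_iInf hp μ ν, wasserstein_eq_iInf hp ν ρ]
  refine ENNReal.le_iInf₂_add_iInf₂ fun π₁ h₁ π₂ h₂ => ?_
  obtain ⟨γ, hγ₁, hγ₂⟩ := exists_gluing h₁ h₂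
  have hc : γ.map (fun t => (t.1.1, t.2)) ∈ couplings μ ρ := by
    constructor
    · rw [← h₁.1, ← hγ₁, Measure.fst, Measure.fst, Measure.map_map (by fun_prop) (by fun_prop),
        Measure.map_map (by fun_prop) (by fun_prop)]
      rfl
    · rw [← h₂.2, ← hγ₂, Measure.snd, Measure.snd, Measure.map_map (by fun_prop) (by fun_prop),
        Measure.map_map (by fun_prop) (by fun_prop)]
      rfl
  have e₁ : ∫⁻ z, ‖z.1 - z.2‖ₑ ^ p ∂π₁ = ∫⁻ t, ‖t.1.1 - t.1.2‖ₑ ^ p ∂γ := by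
    rw [← hγ₁, lintegral_map (by fun_prop) (by fun_prop)]
  have e₂ : ∫⁻ z, ‖z.1 - z.2‖ₑ ^ p ∂π₂ = ∫⁻ t, ‖t.1.2 - t.2‖ₑ ^ p ∂γ := by
    rw [← hγ₂, lintegral_map (by fun_prop) (by fun_prop)]
  refine (wasserstein_le_of_coupling hp hc).trans ?_
  rw [lintegral_map (by fun_prop) (by fun_prop), e₁, e₂]
  refine le_trans ?_ (ENNReal.lintegral_Lp_add_le (by fun_prop) (by fun_prop) hp)
  have h0 : 0 ≤ p := by linarith
  gcongr with t
  rw [Pi.add_apply, ← sub_add_sub_cancel t.1.1 t.1.2 t.2]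
  exact enorm_add_le _ _

theorem wasserstein_comm {m : ℕ} (p : ℝ) (μ ν : Measure (EuclideanSpace ℝ (Fin m))) :
    wasserstein p μ ν = wasserstein p ν μ := by
  have key : ∀ μ ν : Measure (EuclideanSpace ℝ (Fin m)),
      (⨅ π ∈ couplings μ ν, ∫⁻ z, ‖z.1 - z.2‖ₑ ^ p ∂π) ≤
        ⨅ π ∈ couplings ν μ, ∫⁻ z, ‖z.1 - z.2‖ₑ ^ p ∂π := by
    intro μ ν
    refine le_iInf₂ fun π hπ => ?_
    refine iInf₂_le_of_le (π.map Prod.swap) ⟨?_, ?_⟩ ?_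
    · rw [← hπ.2, Measure.fst_map_swap]
    · rw [← hπ.1, Measure.snd_map_swap]
    · rw [lintegral_map (by fun_prop) (by fun_prop)]
      simp only [Prod.fst_swap, Prod.snd_swap, enorm_sub_rev]
      rfl
  unfold wasserstein
  rw [le_antisymm (key μ ν) (key ν μ)]

/-! ### Empirical measures -/

theorem empirical_map {d m n : ℕ} (x : Fin n → EuclideanSpace ℝ (Fin d))
    {f : EuclideanSpace ℝ (Fin d) → EuclideanSpace ℝ (Fin m)} (hf : Measurable f) :
    (empirical x).map f = empirical fun i => f (x i) := by
  unfold empirical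
  rw [Measure.map_smul]
  congr 1
  rw [← Measure.mapₗ_apply_of_measurable hf, map_sum]
  simp [Measure.mapₗ_apply_of_measurable hf, Measure.map_dirac]

theorem lintegral_empirical {d n : ℕ} (x : Fin n → EuclideanSpace ℝ (Fin d))
    {f : EuclideanSpace ℝ (Fin d) → ℝ≥0∞} (hf : Measurable f) :
    ∫⁻ y, f y ∂(empirical x) = (n : ℝ≥0∞)⁻¹ * ∑ i, f (x i) := by
  unfold empirical
  rw [lintegral_smul_measure, lintegral_finsetSum_measure]
  simp [lintegral_dirac' _ hf]

theorem isProbabilityMeasure_empirical {d n : ℕ} (hn : 1 ≤ n)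
    (x : Fin n → EuclideanSpace ℝ (Fin d)) : IsProbabilityMeasure (empirical x) := by
  constructor
  rw [← lintegral_one, lintegral_empirical x measurable_const]
  have : (n : ℝ≥0∞) ≠ 0 := by exact_mod_cast (by omega : n ≠ 0)
  simp [ENNReal.inv_mul_cancel this]

/-- Index-by-index coupling: both empirical measures are images of the uniform measure on `Fin n`.
-/
theorem wasserstein_empirical_empirical_le {m n : ℕ} {p : ℝ} (hp : 1 ≤ p)
    (x y : Fin n → EuclideanSpace ℝ (Fin m)) :
    wasserstein p (empirical x) (empirical y) ≤
      ((n : ℝ≥0∞)⁻¹ * ∑ i, ‖x i - y i‖ₑ ^ p) ^ (1 / p) := by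
  have key : ∀ z : Fin n → EuclideanSpace ℝ (Fin m),
      empirical z = ((n : ℝ≥0∞)⁻¹ • Measure.count).map z := by
    intro z
    have hz : Measurable z := by fun_prop
    unfold empirical
    rw [Measure.map_smul, Measure.count, Measure.sum_fintype, ← Measure.mapₗ_apply_of_measurable hz,
      map_sum]
    simp [Measure.mapₗ_apply_of_measurable hz, Measure.map_dirac]
  rw [key x, key y]
  refine (wasserstein_map_map_le hp _ (by fun_prop) (by fun_prop)).trans_eq ?_
  rw [lintegral_smul_measure, lintegral_count, tsum_fintype]
  rfl

/-! ### Nets -/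

open Metric Module in
-- Volume comparison: the balls of radius `ε / 2` about the points are disjoint and lie in the ball
-- of radius `1 + ε / 2`.
theorem card_le_of_separated {E : Type*} [NormedAddCommGroup E] [NormedSpace ℝ E]
    [FiniteDimensional ℝ E] {ε : ℝ} (hε : 0 < ε) (s : Finset E) (hs : ∀ c ∈ s, ‖c‖ ≤ 1)
    (h : ∀ c ∈ s, ∀ d ∈ s, c ≠ d → ε ≤ ‖c - d‖) : (s.card : ℝ) ≤ (1 + 2 / ε) ^ finrank ℝ E := by
  borelize E
  let μ : Measure E := Measure.addHaar
  have hδ : 0 < ε / 2 := by positivity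
  have hρ : 0 < 1 + ε / 2 := by positivity
  have D : Set.Pairwise (s : Set E) (Function.onFun Disjoint fun c => ball (c : E) (ε / 2)) := by
    rintro c hc d hd hcd
    apply ball_disjoint_ball
    rw [dist_eq_norm]
    linarith [h c hc d hd hcd]
  have A_subset : (⋃ c ∈ s, ball (c : E) (ε / 2)) ⊆ ball (0 : E) (1 + ε / 2) := by
    refine Set.iUnion₂_subset fun x hx => ball_subset_ball' ?_
    rw [dist_zero_right]
    linarith [hs x hx]
  have I := measure_mono (μ := μ) A_subset
  rw [measure_biUnion_finset D fun c _ => measurableSet_ball] at I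
  simp only [μ.addHaar_ball_of_pos _ hδ, μ.addHaar_ball_of_pos _ hρ, Finset.sum_const,
    nsmul_eq_mul, ← mul_assoc] at I
  have J := (ENNReal.mul_le_mul_iff_left (measure_ball_pos μ _ zero_lt_one).ne'
    measure_ball_lt_top.ne).1 I
  have K := ENNReal.toReal_le_of_le_ofReal (by positivity) J
  rw [ENNReal.toReal_mul, ENNReal.toReal_ofReal (by positivity), ENNReal.toReal_natCast] at K
  have e : 1 + 2 / ε = (1 + ε / 2) / (ε / 2) := by field_simp; ring
  rw [e, div_pow, le_div_iff₀ (by positivity)]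
  exact K

open Module in
-- A separated subset of maximal cardinality is a net, and the volume bound makes the maximum exist.
-- The net lies inside `S`, so in the application the tail condition is available at its points.
theorem exists_finset_net {E : Type*} [NormedAddCommGroup E] [NormedSpace ℝ E]
    [FiniteDimensional ℝ E] {ε : ℝ} (hε : 0 < ε) {S : Set E} (hS : ∀ c ∈ S, ‖c‖ ≤ 1) :
    ∃ T : Finset E, (∀ c ∈ T, c ∈ S) ∧ (∀ x ∈ S, ∃ c ∈ T, ‖x - c‖ ≤ ε) ∧
      (T.card : ℝ) ≤ (1 + 2 / ε) ^ finrank ℝ E := by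
  classical
  let A : Set ℕ := {m | ∃ T : Finset E, (∀ c ∈ T, c ∈ S) ∧
    (∀ c ∈ T, ∀ d ∈ T, c ≠ d → ε ≤ ‖c - d‖) ∧ T.card = m}
  have hne : A.Nonempty := ⟨0, ∅, by simp⟩
  have hb : BddAbove A := by
    refine ⟨⌊(1 + 2 / ε) ^ finrank ℝ E⌋₊, ?_⟩
    rintro _ ⟨T, h1, h2, rfl⟩
    exact Nat.le_floor (card_le_of_separated hε T (fun c hc => hS c (h1 c hc)) h2)
  obtain ⟨T, h1, h2, h3⟩ := Nat.sSup_mem hne hb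
  refine ⟨T, h1, fun x hx => ?_, card_le_of_separated hε T (fun c hc => hS c (h1 c hc)) h2⟩
  by_contra! hcon
  have hxT : x ∉ T := fun h => by
    have := hcon x h
    rw [sub_self, norm_zero] at this
    linarith
  have : (insert x T).card ∈ A := by
    refine ⟨insert x T, ?_, ?_, rfl⟩
    · intro c hc
      rcases Finset.mem_insert.1 hc with rfl | hc
      exacts [hx, h1 c hc]
    · intro c hc d hd hcd
      rw [Finset.mem_insert] at hc hd
      rcases hc with rfl | hc
      · rcases hd with rfl | hd
        exacts [absurd rfl hcd, (hcon d hd).le]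
      · rcases hd with rfl | hd
        · rw [norm_sub_rev]
          exact (hcon c hc).le
        · exact h2 c hc d hd hcd
  have := le_csSup hb this
  rw [Finset.card_insert_of_notMem hxT, h3] at this
  omega

/-! ### Projections -/

theorem proj_apply {d k : ℕ} (E : Matrix (Fin d) (Fin k) ℝ) (x : EuclideanSpace ℝ (Fin d)) :
    proj E x = Matrix.toLpLin 2 2 E.transpose x := rfl

open scoped Matrix.Norms.L2Operator in
theorem norm_proj_sub_proj_le {d k : ℕ} (E F : Matrix (Fin d) (Fin k) ℝ)
    (x : EuclideanSpace ℝ (Fin d)) : ‖proj E x - proj F x‖ ≤ ‖E - F‖ * ‖x‖ := by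
  have h : proj E x - proj F x = proj (E - F) x := by
    simp only [proj_apply, Matrix.transpose_sub, map_sub, LinearMap.sub_apply]
  rw [h, ← Matrix.l2_opNorm_conjTranspose, Matrix.conjTranspose_eq_transpose_of_trivial]
  exact Matrix.l2_opNorm_mulVec _ _

open scoped Matrix.Norms.L2Operator in
theorem norm_le_one_of_mem_stiefel {d k : ℕ} {E : Matrix (Fin d) (Fin k) ℝ} (hE : E ∈ stiefel d k) :
    ‖E‖ ≤ 1 := by
  have h := Matrix.l2_opNorm_conjTranspose_mul_self E
  rw [Matrix.conjTranspose_eq_transpose_of_trivial, show E.transpose * E = 1 from hE,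
    ← Matrix.diagonal_one, Matrix.l2_opNorm_diagonal] at h
  have h2 : ‖(fun _ : Fin k => (1 : ℝ))‖ ≤ 1 := (pi_norm_le_iff_of_nonneg zero_le_one).2 (by simp)
  nlinarith [norm_nonneg E]

open scoped Matrix.Norms.L2Operator in
theorem norm_proj_le {d k : ℕ} {E : Matrix (Fin d) (Fin k) ℝ} (hE : E ∈ stiefel d k)
    (x : EuclideanSpace ℝ (Fin d)) : ‖proj E x‖ ≤ ‖x‖ := by
  have h := norm_proj_sub_proj_le E 0 x
  rw [sub_zero, show proj (0 : Matrix (Fin d) (Fin k) ℝ) x = 0 by simp [proj_apply], sub_zero] at h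
  exact h.trans (mul_le_of_le_one_left (norm_nonneg _) (norm_le_one_of_mem_stiefel hE))

open scoped Matrix.Norms.L2Operator in
/-- A finite net of the Stiefel manifold in operator norm. -/
theorem exists_stiefel_net (d k : ℕ) {ε : ℝ} (hε : 0 < ε) :
    ∃ T : Finset (Matrix (Fin d) (Fin k) ℝ), (∀ E ∈ T, E ∈ stiefel d k) ∧
      (∀ E ∈ stiefel d k, ∃ F ∈ T, ∀ x, ‖proj E x - proj F x‖ ≤ ε * ‖x‖) ∧
      (T.card : ℝ) ≤ (1 + 2 / ε) ^ (d * k) := by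
  -- The operator norm is at most `1` on the Stiefel manifold whatever `k` is, while the Frobenius
  -- norm is `√k`; the exponent is the dimension of the matrix space.
  obtain ⟨T, h1, h2, h3⟩ := exists_finset_net hε
    (fun E (hE : E ∈ stiefel d k) => norm_le_one_of_mem_stiefel hE)
  refine ⟨T, h1, fun E hE => ?_, ?_⟩
  · obtain ⟨F, hF, h⟩ := h2 E hE
    exact ⟨F, hF, fun x => (norm_proj_sub_proj_le E F x).trans (by gcongr)⟩
  · simpa [Module.finrank_matrix] using h3

/-! ### Couplings adapted to nested partitions -/

/-- The distance `|a - b|` of two extended nonnegative numbers. -/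
def absDiff (a b : ℝ≥0∞) : ℝ≥0∞ := (a - b) + (b - a)

/-- Matching as much mass as possible of two finite measures. -/
theorem exists_partial_coupling {X : Type*} [MeasurableSpace X] (α β : Measure X)
    [IsFiniteMeasure α] [IsFiniteMeasure β] :
    ∃ (γ : Measure (X × X)) (α' β' : Measure X), γ ≪ α.prod β ∧
      γ.fst + α' = α ∧ γ.snd + β' = β ∧
      α' Set.univ = α Set.univ - β Set.univ ∧ β' Set.univ = β Set.univ - α Set.univ := by
  set a := α Set.univ with ha
  set b := β Set.univ with hb
  have ha' : a ≠ ⊤ := measure_ne_top _ _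
  have hb' : b ≠ ⊤ := measure_ne_top _ _
  rcases eq_or_ne a 0 with h0 | h0
  · refine ⟨0, 0, β, Measure.AbsolutelyContinuous.zero _, ?_, ?_, ?_, ?_⟩
    · simp [Measure.measure_univ_eq_zero.1 (ha.symm.trans h0)]
    · simp
    · simp [h0]
    · simp [h0, ← hb]
  rcases eq_or_ne b 0 with h1 | h1
  · refine ⟨0, α, 0, Measure.AbsolutelyContinuous.zero _, ?_, ?_, ?_, ?_⟩
    · simp
    · simp [Measure.measure_univ_eq_zero.1 (hb.symm.trans h1)]
    · simp [h1, ← ha]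
    · simp [h1]
  have e : ∀ t c : ℝ≥0∞, c ≠ 0 → c ≠ ⊤ → t ≤ c → t / c + (1 - t / c) = 1 := fun t c h0 h1 h =>
    add_tsub_cancel_of_le (ENNReal.div_le_of_le_mul (by rwa [one_mul]))
  -- A multiple of the product measure, normalized to have mass `min a b`; the leftovers are
  -- multiples of `α` and `β`.
  refine ⟨(min a b / (a * b)) • α.prod β, (1 - min a b / a) • α, (1 - min a b / b) • β,
    Measure.smul_absolutelyContinuous, ?_, ?_, ?_, ?_⟩
  · have h : (min a b / (a * b)) * b = min a b / a := by
      rw [← ENNReal.mul_div_right_comm, ENNReal.mul_div_mul_right _ _ h1 hb']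
    rw [Measure.fst, Measure.map_smul, Measure.map_fst_prod, smul_smul, ← hb, h, ← add_smul,
      e _ _ h0 ha' (min_le_left _ _), one_smul]
  · have h : (min a b / (a * b)) * a = min a b / b := by
      rw [mul_comm a b, ← ENNReal.mul_div_right_comm, ENNReal.mul_div_mul_right _ _ h0 ha']
    rw [Measure.snd, Measure.map_smul, Measure.map_snd_prod, smul_smul, ← ha, h, ← add_smul,
      e _ _ h1 hb' (min_le_right _ _), one_smul]
  · rw [Measure.smul_apply, smul_eq_mul, ← ha, ENNReal.sub_mul (fun _ _ => ha'), one_mul,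
      ENNReal.div_mul_cancel h0 ha']
    rcases le_total a b with h | h <;> simp [h, tsub_eq_zero_of_le]
  · rw [Measure.smul_apply, smul_eq_mul, ← hb, ENNReal.sub_mul (fun _ _ => hb'), one_mul,
      ENNReal.div_mul_cancel h1 hb']
    rcases le_total a b with h | h <;> simp [h, tsub_eq_zero_of_le]

theorem sum_restrict_preimage_singleton {X ι : Type*} [MeasurableSpace X] [Countable ι]
    [MeasurableSpace ι] [MeasurableSingletonClass ι] (α : Measure X) {w : X → ι}
    (hw : Measurable w) : Measure.sum (fun v => α.restrict (w ⁻¹' {v})) = α := by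
  rw [← Measure.restrict_iUnion _ (fun v => hw (measurableSet_singleton v)), ← Set.preimage_iUnion,
    Set.iUnion_of_singleton, Set.preimage_univ, Measure.restrict_univ]
  intro v v' h
  exact Disjoint.preimage _ (by simpa using h)

/-- Matching as much mass as possible inside the cells of a countable partition. -/
theorem exists_partial_coupling_cells {X ι : Type*} [MeasurableSpace X] [Countable ι]
    [MeasurableSpace ι] [MeasurableSingletonClass ι] (α β : Measure X)
    [IsFiniteMeasure α] [IsFiniteMeasure β] {w : X → ι} (hw : Measurable w) :
    ∃ (γ : Measure (X × X)) (α' β' : Measure X), (∀ᵐ t ∂γ, w t.1 = w t.2) ∧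
      γ.fst + α' = α ∧ γ.snd + β' = β ∧
      (∀ v, α' (w ⁻¹' {v}) = α (w ⁻¹' {v}) - β (w ⁻¹' {v})) ∧
      (∀ v, β' (w ⁻¹' {v}) = β (w ⁻¹' {v}) - α (w ⁻¹' {v})) := by
  have hm : ∀ v, MeasurableSet (w ⁻¹' {v}) := fun v => hw (measurableSet_singleton v)
  choose γ α' β' h1 h2 h3 h4 h5 using fun v =>
    exists_partial_coupling (α.restrict (w ⁻¹' {v})) (β.restrict (w ⁻¹' {v}))
  -- Each leftover lives on its own cell, so the sum gives that cell exactly the total mass of one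
  -- summand.
  have hsupp : ∀ (δ : ι → Measure X) (ρ : Measure X), (∀ v, δ v ≤ ρ.restrict (w ⁻¹' {v})) →
      ∀ v, Measure.sum δ (w ⁻¹' {v}) = δ v Set.univ := by
    intro δ ρ h v
    have h0 : ∀ v' , v' ≠ v → δ v' (w ⁻¹' {v}) = 0 := by
      intro v' hv
      refine le_antisymm ((h v' _).trans_eq ?_) zero_le
      rw [Measure.restrict_apply (hm v), ← Set.preimage_inter,
        Set.singleton_inter_eq_empty.2 (by simpa using hv.symm)]
      simp
    rw [Measure.sum_apply _ (hm v), tsum_eq_single v h0]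
    refine le_antisymm (measure_mono (Set.subset_univ _)) ?_
    have : δ v (w ⁻¹' {v})ᶜ = 0 :=
      le_antisymm ((h v _).trans_eq (by simp [Measure.restrict_apply (hm v).compl])) zero_le
    rw [← measure_add_measure_compl (hm v), this, add_zero]
  refine ⟨Measure.sum γ, Measure.sum α', Measure.sum β', ?_, ?_, ?_, ?_, ?_⟩
  · rw [Measure.ae_sum_iff]
    intro v
    refine (h1 v).ae_le ?_
    rw [Measure.prod_restrict]
    filter_upwards [ae_restrict_mem ((hm v).prod (hm v))] with t ht
    exact (show w t.1 = v from ht.1).trans (show w t.2 = v from ht.2).symm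
  · rw [Measure.fst_sum, Measure.sum_add_sum]
    simp_rw [h2]
    exact sum_restrict_preimage_singleton α hw
  · rw [Measure.snd_sum, Measure.sum_add_sum]
    simp_rw [h3]
    exact sum_restrict_preimage_singleton β hw
  · intro v
    rw [hsupp α' α (fun v => ?_) v, h4]
    · simp
    · conv_rhs => rw [← h2 v]
      exact Measure.le_add_left le_rfl
  · intro v
    rw [hsupp β' β (fun v => ?_) v, h5]
    · simp
    · conv_rhs => rw [← h3 v]
      exact Measure.le_add_left le_rfl

theorem lintegral_comp_countable {X ι : Type*} [MeasurableSpace X] [Countable ι]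
    [MeasurableSpace ι] [MeasurableSingletonClass ι] (α : Measure X) {w : X → ι}
    (hw : Measurable w) (S : ι → ℝ≥0∞) :
    ∫⁻ x, S (w x) ∂α = ∑' v, S v * α (w ⁻¹' {v}) := by
  have hS : Measurable S := measurable_of_countable S
  rw [← lintegral_map hS hw, lintegral_countable']
  simp_rw [Measure.map_apply hw (measurableSet_singleton _)]

/-- If `c ≤ s j x + s j y` on the cells of the `j`-th of a sequence of nested partitions, the optimal
transport cost is controlled by the differences of the masses of the cells. -/
theorem exists_coupling_nested {X ι : Type*} [MeasurableSpace X] [Countable ι]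
    [MeasurableSpace ι] [MeasurableSingletonClass ι] (c : X × X → ℝ≥0∞) (z : ℕ → X → ι)
    (s : ℕ → X → ℝ≥0∞) (S : ℕ → ι → ℝ≥0∞) (J : ℕ) (hz : ∀ j, Measurable (z j))
    (hz0 : ∀ x y, z 0 x = z 0 y)
    (hnest : ∀ j < J, ∀ x y, z (j + 1) x = z (j + 1) y → z j x = z j y)
    (hs : ∀ j, Measurable (s j)) (hS : ∀ j < J, ∀ x, s j x = S j (z (j + 1) x))
    (hc : ∀ j ≤ J, ∀ x y, z j x = z j y → c (x, y) ≤ s j x + s j y)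
    (α β : Measure X) [IsFiniteMeasure α] [IsFiniteMeasure β] (hαβ : α Set.univ = β Set.univ) :
    ∃ γ : Measure (X × X), γ.fst = α ∧ γ.snd = β ∧
      ∫⁻ t, c t ∂γ ≤ ∫⁻ x, s J x ∂α + ∫⁻ x, s J x ∂β +
        ∑ j ∈ Finset.range J, ∑' v, S j v *
          absDiff (α (z (j + 1) ⁻¹' {v})) (β (z (j + 1) ⁻¹' {v})) := by
  have cost : ∀ (γ : Measure (X × X)) (j : ℕ), j ≤ J → (∀ᵐ t ∂γ, z j t.1 = z j t.2) →
      ∫⁻ t, c t ∂γ ≤ ∫⁻ x, s j x ∂γ.fst + ∫⁻ x, s j x ∂γ.snd := by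
    intro γ j hj h
    rw [Measure.fst, Measure.snd, lintegral_map (hs j) measurable_fst,
      lintegral_map (hs j) measurable_snd,
      ← lintegral_add_left (f := fun t : X × X => s j t.1) ((hs j).comp measurable_fst)]
    refine lintegral_mono_ae ?_
    filter_upwards [h] with t ht
    exact hc j hj _ _ ht
  induction J generalizing α β with
  | zero =>
    obtain ⟨γ, α', β', h1, h2, h3, h4, h5⟩ := exists_partial_coupling_cells α β (hz 0)
    -- Level `0` has a single cell, so equal total masses leave nothing unmatched.
    have hα : α' = 0 := by
      rw [← Measure.measure_univ_eq_zero]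
      rcases isEmpty_or_nonempty X with hX | ⟨⟨x⟩⟩
      · simp [Set.univ_eq_empty_iff.2 hX]
      · have : z 0 ⁻¹' {z 0 x} = Set.univ := Set.eq_univ_of_forall fun y => hz0 y x
        rw [← this, h4, this, hαβ, tsub_self]
    have hβ : β' = 0 := by
      rw [← Measure.measure_univ_eq_zero]
      rcases isEmpty_or_nonempty X with hX | ⟨⟨x⟩⟩
      · simp [Set.univ_eq_empty_iff.2 hX]
      · have : z 0 ⁻¹' {z 0 x} = Set.univ := Set.eq_univ_of_forall fun y => hz0 y x
        rw [← this, h5, this, hαβ, tsub_self]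
    subst hα hβ
    rw [add_zero] at h2 h3
    refine ⟨γ, h2, h3, ?_⟩
    have := cost γ 0 le_rfl h1
    rw [h2, h3] at this
    simpa using this
  | succ J ih =>
    -- Match as much as possible in the finest cells, at scale `s (J + 1)`; the surplus goes to the
    -- coarser levels by induction.
    obtain ⟨γ, α', β', h1, h2, h3, h4, h5⟩ := exists_partial_coupling_cells α β (hz (J + 1))
    have hle : γ.fst ≤ α := h2 ▸ Measure.le_add_right le_rfl
    have hle' : α' ≤ α := h2 ▸ Measure.le_add_left le_rfl
    have hle2 : γ.snd ≤ β := h3 ▸ Measure.le_add_right le_rfl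
    have hle2' : β' ≤ β := h3 ▸ Measure.le_add_left le_rfl
    have : IsFiniteMeasure α' := isFiniteMeasure_of_le α hle'
    have : IsFiniteMeasure β' := isFiniteMeasure_of_le β hle2'
    have : IsFiniteMeasure γ.fst := isFiniteMeasure_of_le α hle
    have hnest' : ∀ j ≤ J + 1, ∀ x y, z (J + 1) x = z (J + 1) y → z j x = z j y := by
      intro j hj x y h
      induction hj using Nat.decreasingInduction with
      | self => exact h
      | of_succ j hj ih => exact hnest j hj x y ih
    -- Matched pairs share a cell at every coarser level too, so removing them leaves all
    -- discrepancies of cell masses unchanged.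
    have hbal : ∀ j ≤ J + 1, ∀ v, γ.fst (z j ⁻¹' {v}) = γ.snd (z j ⁻¹' {v}) := by
      intro j hj v
      have hm := hz j (measurableSet_singleton v)
      rw [Measure.fst_apply hm, Measure.snd_apply hm]
      refine measure_congr ?_
      filter_upwards [h1] with t ht
      have := hnest' j hj _ _ ht
      exact propext (Eq.congr this rfl)
    have hdiff : ∀ j ≤ J + 1, ∀ v, absDiff (α' (z j ⁻¹' {v})) (β' (z j ⁻¹' {v})) =
        absDiff (α (z j ⁻¹' {v})) (β (z j ⁻¹' {v})) := by
      intro j hj v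
      have hfin : γ.snd (z j ⁻¹' {v}) ≠ ⊤ := by
        rw [← hbal j hj v]
        exact measure_ne_top _ _
      conv_rhs => rw [← h2, ← h3]
      rw [Measure.add_apply, Measure.add_apply, hbal j hj v]
      unfold absDiff
      rw [ENNReal.add_sub_add_eq_sub_left hfin, ENNReal.add_sub_add_eq_sub_left hfin]
    have huniv : α' Set.univ = β' Set.univ := by
      have e : γ.fst Set.univ = γ.snd Set.univ := by rw [Measure.fst_univ, Measure.snd_univ]
      have h := hαβ
      conv_lhs at h => rw [← h2]
      conv_rhs at h => rw [← h3]
      rw [Measure.add_apply, Measure.add_apply, ← e] at h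
      exact (ENNReal.add_right_inj (measure_ne_top _ _)).1 h
    obtain ⟨γ', h1', h2', h3'⟩ := ih (fun j hj => hnest j (by omega)) (fun j hj => hS j (by omega))
      (fun j hj => hc j (by omega)) α' β' huniv (fun γ j hj => cost γ j (by omega))
    refine ⟨γ + γ', ?_, ?_, ?_⟩
    · rw [Measure.fst_add, h1', h2]
    · rw [Measure.snd_add, h2', h3]
    · rw [lintegral_add_measure]
      have hc1 : ∫⁻ t, c t ∂γ ≤ ∫⁻ x, s (J + 1) x ∂α + ∫⁻ x, s (J + 1) x ∂β :=
        (cost γ (J + 1) le_rfl h1).trans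
          (add_le_add (lintegral_mono' hle le_rfl) (lintegral_mono' hle2 le_rfl))
      refine add_le_add hc1 (h3'.trans ?_)
      rw [Finset.sum_range_succ, add_comm]
      refine add_le_add (Finset.sum_le_sum fun j hj => ?_) ?_
      · have hj := Finset.mem_range.1 hj
        simp_rw [hdiff (j + 1) (by omega)]
        exact le_rfl
      -- The scale `s J` is constant on cells of level `J + 1`, where the two surplus masses add up
      -- exactly to the discrepancy.
      · simp_rw [hS J (by omega)]
        rw [lintegral_comp_countable α' (hz (J + 1)), lintegral_comp_countable β' (hz (J + 1)),
          ← ENNReal.tsum_add]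
        simp_rw [h4, h5, ← mul_add]
        exact le_rfl

/-! ### Nested partitions of the Euclidean space -/

/-- Nearest-point map onto a net of the unit ball, recorded by the index of the net point so that
the cells are measurable and labelled by integers. -/
theorem exists_quantizer (k : ℕ) {ε : ℝ} (hε : 0 < ε) :
    ∃ (M : ℕ) (f : EuclideanSpace ℝ (Fin k) → ℕ) (e : ℕ → EuclideanSpace ℝ (Fin k)),
      Measurable f ∧ (∀ x, f x < M) ∧ (∀ x, ‖e (f x)‖ ≤ 1) ∧ (∀ x, ‖x‖ ≤ 1 → ‖x - e (f x)‖ ≤ ε) ∧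
      (M : ℝ) ≤ (1 + 2 / ε) ^ k := by
  obtain ⟨T, h1, h2, h3⟩ := exists_finset_net hε
    (S := Metric.closedBall (0 : EuclideanSpace ℝ (Fin k)) 1) (fun c hc => by simpa using hc)
  obtain ⟨c0, hc0, -⟩ := h2 0 (by simp)
  have hM : T.card - 1 + 1 = T.card := Nat.sub_add_cancel (Finset.card_pos.2 ⟨c0, hc0⟩)
  let e : ℕ → EuclideanSpace ℝ (Fin k) := fun i =>
    if h : i < T.card then T.equivFin.symm ⟨i, h⟩ else 0
  have hf : ∀ x, SimpleFunc.nearestPtInd e (T.card - 1) x < T.card := fun x =>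
    lt_of_le_of_lt (SimpleFunc.nearestPtInd_le e (T.card - 1) x) (by omega)
  refine ⟨T.card, SimpleFunc.nearestPtInd e (T.card - 1), e, SimpleFunc.measurable _, hf,
    fun x => ?_, fun x hx => ?_, by simpa using h3⟩
  · have : e (SimpleFunc.nearestPtInd e (T.card - 1) x) ∈ T := by
      simp only [e, hf x, dif_pos]
      exact Subtype.coe_prop _
    simpa using h1 _ this
  · obtain ⟨c, hc, hxc⟩ := h2 x (by simpa using hx)
    set i := T.equivFin ⟨c, hc⟩ with hi
    have hei : e i = c := by
      simp [e, hi]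
    have := SimpleFunc.edist_nearestPt_le e x (k := i) (N := T.card - 1) (by omega)
    rw [hei, edist_dist, edist_dist, ENNReal.ofReal_le_ofReal_iff dist_nonneg, dist_comm,
      dist_eq_norm, dist_comm, dist_eq_norm] at this
    exact this.trans hxc

/-- Nested partitions of the unit ball into at most `(3 * 2 ^ j) ^ k` cells of diameter at most
`4 / 2 ^ j`. -/
theorem exists_nested_quantizer (k J : ℕ) :
    ∃ f : ℕ → EuclideanSpace ℝ (Fin k) → ℕ, ∃ M : ℕ → ℕ,
      (∀ j, Measurable (f j)) ∧
      (∀ j ≤ J, ∀ x, f j x < M j) ∧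
      (∀ j ≤ J, (M j : ℝ) ≤ (3 * 2 ^ j) ^ k) ∧
      (∀ j < J, ∀ x y, f (j + 1) x = f (j + 1) y → f j x = f j y) ∧
      (∀ j ≤ J, ∀ x y, ‖x‖ ≤ 1 → ‖y‖ ≤ 1 → f j x = f j y →
        ‖x - y‖ ≤ 4 / 2 ^ j - 2 / 2 ^ J) := by
  induction J with
  | zero =>
    refine ⟨fun _ _ => 0, fun _ => 1, fun _ => measurable_const, fun _ _ _ => zero_lt_one, ?_,
      fun _ _ _ _ _ => rfl, ?_⟩
    · intro j hj
      rw [Nat.le_zero.1 hj]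
      simpa using one_le_pow₀ (by norm_num : (1 : ℝ) ≤ 3)
    · intro j hj x y hx hy _
      rw [Nat.le_zero.1 hj]
      have := norm_sub_le x y
      norm_num
      linarith
  | succ J ih =>
    obtain ⟨f, M, h1, h2, h3, h4, h5⟩ := ih
    obtain ⟨N, g, e, g1, g2, g3, g4, g5⟩ :=
      exists_quantizer k (ε := 1 / 2 ^ (J + 1)) (by positivity)
    have he : Measurable e := measurable_of_countable e
    have hne : ∀ j ≤ J, j ≠ J + 1 := fun j hj => by omega
    -- Coarser labels are read at the quantized point `e (g x)`, which forces nestedness. This moves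
    -- two points apart by up to `2 / 2 ^ (J + 1)`, which is what the slack `- 2 / 2 ^ J` in the
    -- diameter bound pays for.
    refine ⟨fun j x => if j = J + 1 then g x else f j (e (g x)),
      fun j => if j = J + 1 then N else M j, ?_, ?_, ?_, ?_, ?_⟩
    · intro j
      beta_reduce
      split_ifs
      · exact g1
      · exact (h1 j).comp (he.comp g1)
    · intro j hj x
      rcases Nat.le_add_one_iff.1 hj with hj | rfl
      · simpa only [hne j hj, if_false] using h2 j hj _
      · simpa only [if_true] using g2 x
    · intro j hj
      rcases Nat.le_add_one_iff.1 hj with hj | rfl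
      · simpa only [hne j hj, if_false] using h3 j hj
      · simp only [if_true]
        refine g5.trans ?_
        gcongr
        rw [div_div_eq_mul_div, div_one]
        linarith [one_le_pow₀ (by norm_num : (1 : ℝ) ≤ 2) (n := J + 1)]
    · intro j hj x y hxy
      simp only [hne j (by omega), if_false]
      rcases Nat.lt_succ_iff_lt_or_eq.1 hj with hj | rfl
      · simp only [hne (j + 1) (by omega), if_false] at hxy
        exact h4 j hj _ _ hxy
      · simp only [if_true] at hxy
        rw [hxy]
    · intro j hj x y hx hy hxy
      have hd : ‖x - y‖ ≤ ‖e (g x) - e (g y)‖ + 2 / 2 ^ (J + 1) := by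
        have e1 : x - y = (e (g x) - e (g y)) + ((x - e (g x)) - (y - e (g y))) := by abel
        have e2 := norm_add_le (e (g x) - e (g y)) ((x - e (g x)) - (y - e (g y)))
        have e3 := norm_sub_le (x - e (g x)) (y - e (g y))
        have e4 := g4 x hx
        have e5 := g4 y hy
        rw [← e1] at e2
        have : (2 : ℝ) / 2 ^ (J + 1) = 1 / 2 ^ (J + 1) + 1 / 2 ^ (J + 1) := by ring
        linarith
      rcases Nat.le_add_one_iff.1 hj with hj | rfl
      · simp only [hne j hj, if_false] at hxy
        have := h5 j hj _ _ (g3 x) (g3 y) hxy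
        have e6 : (2 : ℝ) / 2 ^ J = 2 * (2 / 2 ^ (J + 1)) := by rw [pow_succ]; field_simp
        linarith
      · simp only [if_true] at hxy
        rw [hxy, sub_self, norm_zero] at hd
        refine hd.trans (le_of_eq ?_)
        ring

/-- The index of the dyadic shell containing `x`, at scale `R`. -/
def shell {k : ℕ} (R : ℝ) (x : EuclideanSpace ℝ (Fin k)) : ℕ := ⌈Real.logb 2 (‖x‖ / R)⌉₊

theorem measurable_shell {k : ℕ} (R : ℝ) :
    Measurable (shell R : EuclideanSpace ℝ (Fin k) → ℕ) := by
  unfold shell Real.logb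
  fun_prop

theorem norm_le_shell {k : ℕ} {R : ℝ} (hR : 0 < R) (x : EuclideanSpace ℝ (Fin k)) :
    ‖x‖ ≤ R * 2 ^ shell R x := by
  rcases eq_or_ne x 0 with rfl | hx
  · rw [norm_zero]; positivity
  have hx : 0 < ‖x‖ / R := div_pos (norm_pos_iff.2 hx) hR
  rw [← div_le_iff₀' hR, ← Real.rpow_natCast, ← Real.logb_le_iff_le_rpow (by norm_num) hx]
  exact Nat.le_ceil _

/-- Only positive indices carry a lower bound: the ceiling in `ℕ` sends the whole ball of radius `R`
to shell `0`. -/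
theorem lt_norm_of_shell {k : ℕ} {R : ℝ} (hR : 0 < R) {x : EuclideanSpace ℝ (Fin k)} {l : ℕ}
    (h : shell R x = l + 1) : R * 2 ^ l < ‖x‖ := by
  rcases eq_or_ne x 0 with rfl | hx
  · simp [shell] at h
  have hx : 0 < ‖x‖ / R := div_pos (norm_pos_iff.2 hx) hR
  rw [← lt_div_iff₀' hR, ← Real.rpow_natCast, ← Real.lt_logb_iff_rpow_lt (by norm_num) hx]
  exact Nat.lt_ceil.1 (by unfold shell at h; omega)

/-! ### The mean of the Wasserstein distance to the empirical measure -/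

theorem absDiff_ofReal {a b : ℝ} (ha : 0 ≤ a) (hb : 0 ≤ b) :
    absDiff (ENNReal.ofReal a) (ENNReal.ofReal b) = ENNReal.ofReal |a - b| := by
  unfold absDiff
  rw [← ENNReal.ofReal_sub _ hb, ← ENNReal.ofReal_sub _ ha]
  rcases le_total a b with h | h
  · rw [ENNReal.ofReal_of_nonpos (sub_nonpos.2 h), zero_add, abs_sub_comm,
      abs_of_nonneg (sub_nonneg.2 h)]
  · rw [ENNReal.ofReal_of_nonpos (sub_nonpos.2 h), add_zero, abs_of_nonneg (sub_nonneg.2 h)]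

theorem lintegral_rpow_inv_le {α : Type*} [MeasurableSpace α] {μ : Measure α}
    [IsProbabilityMeasure μ] {p : ℝ} (hp : 1 ≤ p) {G : α → ℝ≥0∞} (hG : AEMeasurable G μ) :
    ∫⁻ x, G x ^ (1 / p) ∂μ ≤ (∫⁻ x, G x ∂μ) ^ (1 / p) := by
  have h0 : p ≠ 0 := by linarith
  have h := eLpNorm'_le_eLpNorm'_of_exponent_le (f := fun x => G x ^ (1 / p)) zero_lt_one hp μ
    (hG.pow_const _).aestronglyMeasurable
  simpa [eLpNorm', ← ENNReal.rpow_mul, h0] using h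

theorem lintegral_pi_eval {α : Type*} [MeasurableSpace α] (ν : Measure α) [IsProbabilityMeasure ν]
    {n : ℕ} (i : Fin n) {f : α → ℝ≥0∞} (hf : Measurable f) :
    ∫⁻ y, f (y i) ∂(Measure.pi fun _ : Fin n => ν) = ∫⁻ x, f x ∂ν :=
  (measurePreserving_eval (fun _ : Fin n => ν) i).lintegral_comp hf

theorem lintegral_lintegral_empirical {d n : ℕ} (hn : 1 ≤ n)
    (ν : Measure (EuclideanSpace ℝ (Fin d))) [IsProbabilityMeasure ν]
    {f : EuclideanSpace ℝ (Fin d) → ℝ≥0∞} (hf : Measurable f) :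
    ∫⁻ y, ∫⁻ x, f x ∂(empirical y) ∂(Measure.pi fun _ : Fin n => ν) = ∫⁻ x, f x ∂ν := by
  simp_rw [fun y : Fin n → EuclideanSpace ℝ (Fin d) => lintegral_empirical y hf]
  rw [lintegral_const_mul _ (by fun_prop), lintegral_finsetSum _ (by fun_prop)]
  simp_rw [fun i => lintegral_pi_eval ν (n := n) i hf]
  have h : (n : ℝ≥0∞) ≠ 0 := by exact_mod_cast (by omega : n ≠ 0)
  simp [← mul_assoc, ENNReal.inv_mul_cancel h]

theorem empirical_apply {d n : ℕ} {A : Set (EuclideanSpace ℝ (Fin d))} (hA : MeasurableSet A)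
    (y : Fin n → EuclideanSpace ℝ (Fin d)) :
    empirical y A = (n : ℝ≥0∞)⁻¹ * ∑ i, A.indicator (fun _ => 1) (y i) := by
  rw [← lintegral_empirical y (measurable_const.indicator hA), lintegral_indicator_const hA,
    one_mul]

theorem measurable_empirical_apply {d n : ℕ} {A : Set (EuclideanSpace ℝ (Fin d))}
    (hA : MeasurableSet A) :
    Measurable fun y : Fin n → EuclideanSpace ℝ (Fin d) => empirical y A := by
  simp_rw [empirical_apply hA]
  have : Measurable (A.indicator fun _ => (1 : ℝ≥0∞)) := measurable_const.indicator hA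
  fun_prop

/-- The mean absolute deviation is at most the standard deviation; an indicator has variance at most
its mean, and independence divides it by `n`. -/
theorem lintegral_absDiff_empirical_le {d n : ℕ} (hn : 1 ≤ n)
    (ν : Measure (EuclideanSpace ℝ (Fin d))) [IsProbabilityMeasure ν]
    {A : Set (EuclideanSpace ℝ (Fin d))} (hA : MeasurableSet A) :
    ∫⁻ y, absDiff (empirical y A) (ν A) ∂(Measure.pi fun _ : Fin n => ν) ≤
      (ν A / n) ^ (1 / 2 : ℝ) := by
  set P := Measure.pi fun _ : Fin n => ν with hP
  have hn0 : (n : ℝ) ≠ 0 := by exact_mod_cast (by omega : n ≠ 0)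
  let g : EuclideanSpace ℝ (Fin d) → ℝ := A.indicator fun _ => 1
  have hg : Measurable g := measurable_const.indicator hA
  have hgL : MemLp g 2 ν := memLp_indicator_const 2 hA 1 (Or.inr (measure_ne_top _ _))
  have hgi : ∫ x, g x ∂ν = ν.real A := by
    simp [g, integral_indicator hA]
  let W : (Fin n → EuclideanSpace ℝ (Fin d)) → ℝ := fun y => (n : ℝ)⁻¹ * ∑ i, g (y i)
  have hev : ∀ i, MemLp (fun y : Fin n → EuclideanSpace ℝ (Fin d) => g (y i)) 2 P := fun i =>
    hgL.comp_measurePreserving (measurePreserving_eval (fun _ : Fin n => ν) i)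
  have hWL : MemLp W 2 P := (memLp_finsetSum _ fun i _ => hev i).const_mul _
  have hevi : ∀ i, ∫ y, g (y i) ∂P = ν.real A := fun i => by
    rw [← hgi]
    have := (measurePreserving_eval (fun _ : Fin n => ν) i)
    rw [← this.map_eq, integral_map this.measurable.aemeasurable hg.aestronglyMeasurable]
  have hWi : ∫ y, W y ∂P = ν.real A := by
    simp only [W]
    rw [integral_const_mul, integral_finsetSum _ fun i _ => (hev i).integrable (by norm_num)]
    simp only [hevi, Finset.sum_const, Finset.card_univ, Fintype.card_fin, nsmul_eq_mul]
    rw [inv_mul_cancel_left₀ hn0]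
  have hvar1 : Var[g; ν] ≤ ν.real A := by
    refine (variance_le_expectation_sq hg.aestronglyMeasurable).trans_eq ?_
    rw [← hgi]
    refine integral_congr_ae (Filter.Eventually.of_forall fun x => ?_)
    by_cases hx : x ∈ A <;> simp [g, hx]
  have hvar : Var[W; P] ≤ ν.real A / n := by
    have e : W = fun y => (n : ℝ)⁻¹ * (∑ i, fun y : Fin n → EuclideanSpace ℝ (Fin d) => g (y i)) y := by
      funext y
      simp [W]
    rw [e, variance_const_mul, IndepFun.variance_sum (fun i _ => hev i)
      (fun i _ j _ hij => (iIndepFun_pi (fun _ => hg.aemeasurable)).indepFun hij)]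
    have : ∀ i : Fin n, Var[fun y : Fin n → EuclideanSpace ℝ (Fin d) => g (y i); P] = Var[g; ν] := by
      intro i
      have := (measurePreserving_eval (fun _ : Fin n => ν) i)
      conv_rhs => rw [← this.map_eq, variance_map (by fun_prop) this.measurable.aemeasurable]
      rfl
    simp only [this, Finset.sum_const, Finset.card_univ, Fintype.card_fin, nsmul_eq_mul]
    rw [div_eq_inv_mul, sq, mul_assoc, inv_mul_cancel_left₀ hn0]
    gcongr
  have hemp : ∀ y : Fin n → EuclideanSpace ℝ (Fin d), empirical y A = ENNReal.ofReal (W y) := by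
    intro y
    rw [empirical_apply hA,
      ENNReal.ofReal_mul (by positivity), ENNReal.ofReal_inv_of_pos (by positivity),
      ENNReal.ofReal_natCast, ENNReal.ofReal_sum_of_nonneg fun i _ =>
        Set.indicator_nonneg (fun _ _ => zero_le_one) _]
    congr 2 with i
    by_cases hx : y i ∈ A <;> simp [hx]
  have hW0 : ∀ y, 0 ≤ W y := fun y => mul_nonneg (by positivity)
    (Finset.sum_nonneg fun i _ => Set.indicator_nonneg (fun _ _ => zero_le_one) _)
  have hνA : ν A = ENNReal.ofReal (ν.real A) := (ofReal_measureReal (measure_ne_top _ _)).symm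
  have hpt : ∀ y, absDiff (empirical y A) (ν A) = (‖W y - ∫ z, W z ∂P‖ₑ ^ 2) ^ (1 / (2 : ℝ)) := by
    intro y
    rw [hemp, hνA, absDiff_ofReal (hW0 y) measureReal_nonneg, hWi, ← ENNReal.rpow_natCast,
      ← ENNReal.rpow_mul, ← Real.enorm_eq_ofReal_abs]
    norm_num
  simp_rw [hpt]
  refine (lintegral_rpow_inv_le (by norm_num) ?_).trans ?_
  · exact (hWL.aestronglyMeasurable.aemeasurable.sub_const _).enorm.pow_const _
  · refine ENNReal.rpow_le_rpow ?_ (by norm_num)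
    rw [← evariance, ← hWL.ofReal_variance_eq, hνA, ← ENNReal.ofReal_natCast n,
      ← ENNReal.ofReal_div_of_pos (by positivity)]
    exact ENNReal.ofReal_le_ofReal hvar

/-! ### Chaining over shells and cells -/

theorem sum_sqrt_le (a : ℕ → ℝ≥0∞) (M : ℕ) :
    ∑ i ∈ Finset.range M, a i ^ (1 / 2 : ℝ) ≤
      (M : ℝ≥0∞) ^ (1 / 2 : ℝ) * (∑ i ∈ Finset.range M, a i) ^ (1 / 2 : ℝ) := by
  have h := ENNReal.inner_le_Lp_mul_Lq (Finset.range M) (fun _ => 1)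
    (fun i => a i ^ (1 / 2 : ℝ)) Real.HolderConjugate.two_two
  have hs : ∀ i, (a i ^ (1 / 2 : ℝ)) ^ (2 : ℝ) = a i := fun i => by
    rw [← ENNReal.rpow_mul]
    norm_num
  simpa only [hs, one_mul, ENNReal.one_rpow, Finset.sum_const, Finset.card_range, nsmul_eq_mul,
    mul_one] using h

/-- The scale of the cells of level `j` of the nested partition, to the power `p`. -/
def cellScale (p R : ℝ) (j : ℕ) : ℝ≥0∞ := ENNReal.ofReal ((4 * R / 2 ^ j) ^ p)

/-- The relative size of the `l`-th shell, to the power `p`. -/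
def shellScale (p : ℝ) (l : ℕ) : ℝ≥0∞ := ENNReal.ofReal ((2 ^ l : ℝ) ^ p)

/-- Markov's inequality for the `r`-th moment; on shell `0` the trivial bound `1` suffices since `D
≥ 1`. -/
theorem measure_shell_le {k r : ℕ} {R D : ℝ} (hR : 0 < R) (hD : 1 ≤ D)
    (ν : Measure (EuclideanSpace ℝ (Fin k))) [IsProbabilityMeasure ν]
    (hν : ∫⁻ y, ‖y‖ₑ ^ r ∂ν ≤ ENNReal.ofReal (D * R ^ r)) (l : ℕ) :
    ν (shell R ⁻¹' {l}) ≤ ENNReal.ofReal (D * 2 ^ r * ((2 ^ l : ℝ) ^ r)⁻¹) := by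
  cases l with
  | zero =>
    refine prob_le_one.trans ?_
    rw [ENNReal.one_le_ofReal]
    simpa using one_le_mul_of_one_le_of_one_le hD (one_le_pow₀ (by norm_num : (1 : ℝ) ≤ 2))
  | succ l =>
    have h1 : ν (shell R ⁻¹' {l + 1}) ≤ ν {y | ENNReal.ofReal ((R * 2 ^ l) ^ r) ≤ ‖y‖ₑ ^ r} := by
      refine measure_mono fun x hx => ?_
      rw [Set.mem_ofPred_eq, ← ofReal_norm, ← ENNReal.ofReal_pow (norm_nonneg _)]
      exact ENNReal.ofReal_le_ofReal
        (pow_le_pow_left₀ (by positivity) (lt_norm_of_shell hR hx).le _)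
    have h0 : (0 : ℝ) < (R * 2 ^ l) ^ r := by positivity
    refine h1.trans ((meas_ge_le_lintegral_div (by fun_prop) (by simpa using h0)
      ENNReal.ofReal_ne_top).trans ?_)
    refine (ENNReal.div_le_div_right hν _).trans ?_
    rw [← ENNReal.ofReal_div_of_pos h0]
    refine ENNReal.ofReal_le_ofReal (le_of_eq ?_)
    rw [mul_pow, pow_succ, mul_pow]
    field_simp

/-- The square root is that of the standard deviation. It halves the decay `2 ^ (-l r)`, and `r ≥ 2
p + 2` still leaves `2 ^ (-l)` after the factor `2 ^ (l p)`. -/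
theorem tsum_shell_le {k r : ℕ} {p R D : ℝ} (hr : 2 * p + 2 ≤ r) (hR : 0 < R)
    (hD : 1 ≤ D) (ν : Measure (EuclideanSpace ℝ (Fin k))) [IsProbabilityMeasure ν]
    (hν : ∫⁻ y, ‖y‖ₑ ^ r ∂ν ≤ ENNReal.ofReal (D * R ^ r)) :
    ∑' l, shellScale p l * ν (shell R ⁻¹' {l}) ^ (1 / 2 : ℝ) ≤ ENNReal.ofReal (2 * (D * 2 ^ r)) := by
  have h : ∀ l : ℕ, shellScale p l * ν (shell R ⁻¹' {l}) ^ (1 / 2 : ℝ) ≤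
      ENNReal.ofReal (D * 2 ^ r * (1 / 2) ^ l) := by
    intro l
    have hB : 1 ≤ D * 2 ^ r :=
      one_le_mul_of_one_le_of_one_le hD (one_le_pow₀ (by norm_num : (1 : ℝ) ≤ 2))
    have h2 := ENNReal.rpow_le_rpow (measure_shell_le hR hD ν hν l) (by norm_num : (0 : ℝ) ≤ 1 / 2)
    rw [ENNReal.ofReal_rpow_of_nonneg (by positivity) (by norm_num)] at h2
    refine (mul_le_mul_right h2 _).trans ?_
    rw [shellScale, ← ENNReal.ofReal_mul (by positivity)]
    refine ENNReal.ofReal_le_ofReal ?_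
    have hx : (1 : ℝ) ≤ 2 ^ l := one_le_pow₀ (by norm_num)
    rw [Real.mul_rpow (by positivity) (by positivity), ← Real.rpow_natCast (2 ^ l) r,
      ← Real.rpow_neg (by positivity), ← Real.rpow_mul (by positivity), mul_left_comm,
      ← Real.rpow_add (by positivity), one_div_pow, one_div ((2 : ℝ) ^ l), ← Real.rpow_neg_one (2 ^ l)]
    refine mul_le_mul ?_ (Real.rpow_le_rpow_of_exponent_le hx (by linarith)) (by positivity)
      (by positivity)
    exact (Real.rpow_le_rpow_of_exponent_le hB (by norm_num)).trans_eq (Real.rpow_one _)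
  refine (ENNReal.tsum_le_tsum h).trans ?_
  have hs : HasSum (fun l : ℕ => D * 2 ^ r * (1 / 2) ^ l) (D * 2 ^ r * 2) :=
    hasSum_geometric_two.mul_left _
  rw [← ENNReal.ofReal_tsum_of_nonneg (fun l => by positivity) hs.summable, hs.tsum_eq, mul_comm 2]

/-- Bound on the mean transport cost through a nested partition with `J` levels. -/
theorem lintegral_wasserstein_empirical_le {k n r : ℕ} (J : ℕ) {p R D : ℝ} (hp : 1 ≤ p)
    (hr : 2 * p + 2 ≤ r) (hR : 0 < R) (hD : 1 ≤ D) (hn : 1 ≤ n)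
    (ν : Measure (EuclideanSpace ℝ (Fin k))) [IsProbabilityMeasure ν]
    (hν : ∫⁻ y, ‖y‖ₑ ^ r ∂ν ≤ ENNReal.ofReal (D * R ^ r)) :
    ∫⁻ y, wasserstein p (empirical y) ν ∂(Measure.pi fun _ : Fin n => ν) ≤
      (ENNReal.ofReal (2 * (D * 2 ^ r)) * (2 * cellScale p R J +
        ∑ j ∈ Finset.range J, cellScale p R j *
          ENNReal.ofReal ((3 * 2 ^ (j + 1)) ^ k / n) ^ (1 / 2 : ℝ))) ^ (1 / p) := by
  obtain ⟨f, M, f1, f2, f3, f4, f5⟩ := exists_nested_quantizer k J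
  have hp0 : 0 ≤ p := by linarith
  have hn0 : (0 : ℝ) < n := by exact_mod_cast hn
  set P := Measure.pi fun _ : Fin n => ν with hP
  set H := ENNReal.ofReal (2 * (D * 2 ^ r)) with hH
  have hshell := tsum_shell_le hr hR hD ν hν
  -- Level `0` is the whole space, so mass crosses between shells only at the coarsest level; the
  -- other levels rescale each shell into the unit ball and quantize there.
  let z : ℕ → EuclideanSpace ℝ (Fin k) → ℕ × ℕ := fun j x =>
    if j = 0 then (0, 0) else (shell R x, f j ((R * 2 ^ shell R x)⁻¹ • x))
  let S : ℕ → ℕ × ℕ → ℝ≥0∞ := fun j v => cellScale p R j * shellScale p v.1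
  let s : ℕ → EuclideanSpace ℝ (Fin k) → ℝ≥0∞ := fun j x => cellScale p R j * shellScale p (shell R x)
  have hsh := measurable_shell (k := k) R
  have hz : ∀ j, Measurable (z j) := by
    intro j
    by_cases hj : j = 0
    · simp only [z, hj, if_true]
      exact measurable_const
    · simp only [z, hj, if_false]
      have h2 : Measurable fun x : EuclideanSpace ℝ (Fin k) => (R * 2 ^ shell R x)⁻¹ := by fun_prop
      exact hsh.prodMk ((f1 j).comp (h2.smul measurable_id))
  have hs : ∀ j, Measurable (s j) := fun j =>
    ((measurable_of_countable (shellScale p)).comp hsh).const_mul _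
  have hS : ∀ j x, s j x = S j (z (j + 1) x) := fun j x => by simp [s, S, z]
  have hc : ∀ j ≤ J, ∀ x y, z j x = z j y → ‖x - y‖ₑ ^ p ≤ s j x + s j y := by
    intro j hj x y hxy
    have e1 : ∀ x, s j x = ENNReal.ofReal ((4 * R / 2 ^ j * 2 ^ shell R x) ^ p) := fun x => by
      rw [Real.mul_rpow (by positivity) (by positivity), ENNReal.ofReal_mul (by positivity)]
      rfl
    have key : ∀ w, ‖x - y‖ ≤ 4 * R / 2 ^ j * 2 ^ shell R w → ‖x - y‖ₑ ^ p ≤ s j w := fun w hw => by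
      rw [e1, ← ofReal_norm, ENNReal.ofReal_rpow_of_nonneg (norm_nonneg _) hp0]
      exact ENNReal.ofReal_le_ofReal (Real.rpow_le_rpow (norm_nonneg _) hw hp0)
    by_cases hj0 : j = 0
    · subst hj0
      have h1 := norm_le_shell hR x
      have h2 := norm_le_shell hR y
      have h3 := norm_sub_le x y
      rcases le_total (shell R x) (shell R y) with h | h
      · refine (key y ?_).trans le_add_self
        have := mul_le_mul_of_nonneg_left (pow_le_pow_right₀ (by norm_num : (1 : ℝ) ≤ 2) h) hR.le
        have h0 : 0 ≤ R * 2 ^ shell R y := by positivity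
        rw [pow_zero, div_one]
        linarith
      · refine (key x ?_).trans le_self_add
        have := mul_le_mul_of_nonneg_left (pow_le_pow_right₀ (by norm_num : (1 : ℝ) ≤ 2) h) hR.le
        have h0 : 0 ≤ R * 2 ^ shell R x := by positivity
        rw [pow_zero, div_one]
        linarith
    · simp only [z, hj0, if_false, Prod.mk.injEq] at hxy
      obtain ⟨hl, hf⟩ := hxy
      refine (key x ?_).trans le_self_add
      rw [← hl] at hf
      set a := R * 2 ^ shell R x with ha
      have ha0 : 0 < a := by positivity
      have hu : ∀ w : EuclideanSpace ℝ (Fin k), ‖w‖ ≤ a → ‖a⁻¹ • w‖ ≤ 1 := fun w hw => by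
        rw [norm_smul, norm_inv, Real.norm_of_nonneg ha0.le]
        exact inv_mul_le_one_of_le₀ hw ha0.le
      have h5 := f5 j hj _ _ (hu x (norm_le_shell hR x))
        (hu y (by rw [ha, hl]; exact norm_le_shell hR y)) hf
      rw [← smul_sub, norm_smul, norm_inv, Real.norm_of_nonneg ha0.le,
        inv_mul_le_iff₀ ha0] at h5
      refine h5.trans ?_
      have h6 : (0 : ℝ) ≤ 2 / 2 ^ J := by positivity
      calc a * (4 / 2 ^ j - 2 / 2 ^ J) ≤ a * (4 / 2 ^ j) := by gcongr; linarith
        _ = _ := by rw [ha]; ring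
  have hnest : ∀ j < J, ∀ x y, z (j + 1) x = z (j + 1) y → z j x = z j y := by
    intro j hj x y hxy
    by_cases hj0 : j = 0
    · simp [z, hj0]
    · simp only [z, hj0, if_false, Nat.add_eq_zero_iff, one_ne_zero, and_false, Prod.mk.injEq]
        at hxy ⊢
      exact ⟨hxy.1, f4 j hj _ _ hxy.2⟩
  let G : (Fin n → EuclideanSpace ℝ (Fin k)) → ℝ≥0∞ := fun y =>
    ∫⁻ x, s J x ∂(empirical y) + ∫⁻ x, s J x ∂ν +
      ∑ j ∈ Finset.range J, ∑' v, S j v *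
        absDiff (empirical y (z (j + 1) ⁻¹' {v})) (ν (z (j + 1) ⁻¹' {v}))
  have hW : ∀ y, wasserstein p (empirical y) ν ≤ G y ^ (1 / p) := by
    intro y
    have := isProbabilityMeasure_empirical hn y
    obtain ⟨γ, h1, h2, h3⟩ := exists_coupling_nested (fun t => ‖t.1 - t.2‖ₑ ^ p) z s S J hz
      (fun x y => by simp [z]) hnest hs (fun j _ x => hS j x) hc (empirical y) ν
      (by rw [measure_univ, measure_univ])
    exact (wasserstein_le_of_coupling hp ⟨h1, h2⟩).trans
      (ENNReal.rpow_le_rpow h3 (by positivity))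
  have hm : ∀ j v, MeasurableSet (z j ⁻¹' {v}) := fun j v => hz j (measurableSet_singleton v)
  have hme : Measurable fun y : Fin n → EuclideanSpace ℝ (Fin k) => ∫⁻ x, s J x ∂(empirical y) := by
    simp_rw [fun y : Fin n → EuclideanSpace ℝ (Fin k) => lintegral_empirical y (hs J)]
    have := hs J
    fun_prop
  have hmd : ∀ j v, Measurable fun y : Fin n → EuclideanSpace ℝ (Fin k) =>
      absDiff (empirical y (z (j + 1) ⁻¹' {v})) (ν (z (j + 1) ⁻¹' {v})) := by
    intro j v
    have := measurable_empirical_apply (n := n) (hm (j + 1) v)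
    unfold absDiff
    fun_prop
  have hmG : Measurable G := by
    refine (hme.add measurable_const).add (Finset.measurable_fun_sum _ fun j _ => ?_)
    exact Measurable.tsum fun v => (hmd j v).const_mul _
  have hsJ : ∫⁻ x, s J x ∂ν ≤ H * cellScale p R J := by
    have e : ∫⁻ x, s J x ∂ν = cellScale p R J * ∫⁻ x, shellScale p (shell R x) ∂ν :=
      lintegral_const_mul _ ((measurable_of_countable (shellScale p)).comp hsh)
    rw [e, lintegral_comp_countable ν hsh, mul_comm]
    refine mul_le_mul_left (le_trans (ENNReal.tsum_le_tsum fun l => ?_) hshell) _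
    refine mul_le_mul_right ?_ _
    -- A probability is at most its square root, so the same shell series serves for the terminal
    -- cost.
    have h := ENNReal.rpow_le_rpow_of_exponent_ge (prob_le_one (μ := ν) (s := shell R ⁻¹' {l}))
      (by norm_num : (1 / 2 : ℝ) ≤ 1)
    rwa [ENNReal.rpow_one] at h
  have hlevel : ∀ j < J, ∫⁻ y, ∑' v, S j v *
      absDiff (empirical y (z (j + 1) ⁻¹' {v})) (ν (z (j + 1) ⁻¹' {v})) ∂P ≤
      H * (cellScale p R j * ENNReal.ofReal ((3 * 2 ^ (j + 1)) ^ k / n) ^ (1 / 2 : ℝ)) := by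
    intro j hj
    have hzj : ∀ x, z (j + 1) x = (shell R x, f (j + 1) ((R * 2 ^ shell R x)⁻¹ • x)) := fun x => by
      simp [z]
    rw [lintegral_tsum fun v => ((hmd j v).const_mul _).aemeasurable]
    have e1 : ∀ v, ∫⁻ y, S j v *
        absDiff (empirical y (z (j + 1) ⁻¹' {v})) (ν (z (j + 1) ⁻¹' {v})) ∂P ≤
        S j v * (ν (z (j + 1) ⁻¹' {v}) / n) ^ (1 / 2 : ℝ) := fun v => by
      rw [lintegral_const_mul _ (hmd j v)]
      exact mul_le_mul_right (lintegral_absDiff_empirical_le hn ν (hm _ v)) _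
    refine (ENNReal.tsum_le_tsum e1).trans ?_
    rw [ENNReal.tsum_prod']
    have e2 : ∀ l, ∑' i, S j (l, i) * (ν (z (j + 1) ⁻¹' {(l, i)}) / n) ^ (1 / 2 : ℝ) ≤
        (cellScale p R j * ENNReal.ofReal ((3 * 2 ^ (j + 1)) ^ k / n) ^ (1 / 2 : ℝ)) *
          (shellScale p l * ν (shell R ⁻¹' {l}) ^ (1 / 2 : ℝ)) := by
      intro l
      have h0 : ∀ i ∉ Finset.range (M (j + 1)),
          (ν (z (j + 1) ⁻¹' {(l, i)}) / n) ^ (1 / 2 : ℝ) = 0 := by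
        intro i hi
        have : z (j + 1) ⁻¹' {(l, i)} = ∅ := by
          refine Set.eq_empty_of_forall_notMem fun x hx => hi ?_
          have hx : z (j + 1) x = (l, i) := hx
          rw [hzj, Prod.mk.injEq] at hx
          rw [Finset.mem_range, ← hx.2]
          exact f2 (j + 1) hj _
        rw [this, measure_empty, ENNReal.zero_div, ENNReal.zero_rpow_of_pos (by norm_num)]
      simp only [S]
      rw [ENNReal.tsum_mul_left, tsum_eq_sum h0]
      -- Cauchy–Schwarz over the at most `(3 * 2 ^ (j + 1)) ^ k` cells of one shell, whose masses
      -- sum to at most that of the shell.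
      have h1 : ∑ i ∈ Finset.range (M (j + 1)), (ν (z (j + 1) ⁻¹' {(l, i)}) / n) ^ (1 / 2 : ℝ) ≤
          ENNReal.ofReal ((3 * 2 ^ (j + 1)) ^ k / n) ^ (1 / 2 : ℝ) *
            ν (shell R ⁻¹' {l}) ^ (1 / 2 : ℝ) := by
        refine (sum_sqrt_le _ _).trans ?_
        rw [← ENNReal.mul_rpow_of_nonneg _ _ (by norm_num : (0 : ℝ) ≤ 1 / 2),
          ← ENNReal.mul_rpow_of_nonneg _ _ (by norm_num : (0 : ℝ) ≤ 1 / 2)]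
        refine ENNReal.rpow_le_rpow ?_ (by norm_num)
        have h2 : ∑ i ∈ Finset.range (M (j + 1)), ν (z (j + 1) ⁻¹' {(l, i)}) ≤
            ν (shell R ⁻¹' {l}) := by
          rw [← measure_biUnion_finset _ fun i _ => hm _ _]
          · refine measure_mono (Set.iUnion₂_subset fun i _ x hx => ?_)
            have hx : z (j + 1) x = (l, i) := hx
            rw [hzj, Prod.mk.injEq] at hx
            exact hx.1
          · intro i _ i' _ hi
            exact Disjoint.preimage _ (by simpa using hi)
        simp only [div_eq_mul_inv]
        rw [← Finset.sum_mul, ENNReal.ofReal_mul (by positivity),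
          ENNReal.ofReal_inv_of_pos hn0, ENNReal.ofReal_natCast, mul_comm _ ((n : ℝ≥0∞)⁻¹),
          ← mul_assoc]
        refine mul_le_mul (mul_le_mul_left ?_ _) h2 zero_le zero_le
        rw [← ENNReal.ofReal_natCast]
        exact ENNReal.ofReal_le_ofReal (f3 (j + 1) hj)
      refine (mul_le_mul_right h1 _).trans_eq ?_
      ring
    refine (ENNReal.tsum_le_tsum e2).trans ?_
    rw [ENNReal.tsum_mul_left, mul_comm]
    exact mul_le_mul_left hshell _
  calc ∫⁻ y, wasserstein p (empirical y) ν ∂P ≤ ∫⁻ y, G y ^ (1 / p) ∂P := lintegral_mono hW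
    _ ≤ (∫⁻ y, G y ∂P) ^ (1 / p) := lintegral_rpow_inv_le hp hmG.aemeasurable
    _ ≤ _ := by
      refine ENNReal.rpow_le_rpow ?_ (by positivity)
      simp only [G]
      rw [lintegral_add_left (hme.add_const _), lintegral_add_left hme,
        lintegral_lintegral_empirical hn ν (hs J), lintegral_const, measure_univ, mul_one,
        lintegral_finsetSum _ fun j _ => Measurable.tsum fun v => (hmd j v).const_mul _,
        mul_add, two_mul, mul_add, Finset.mul_sum]
      exact add_le_add (add_le_add hsJ hsJ)
        (Finset.sum_le_sum fun j hj => hlevel j (Finset.mem_range.1 hj))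

/-! ### Exponential moments of functions with bounded differences -/

theorem hasSum_exp_sub (s : ℝ) :
    HasSum (fun r : ℕ => s ^ (r + 2) / (r + 2)!) (Real.exp s - 1 - s) := by
  have h := NormedSpace.expSeries_div_hasSum_exp (𝔸 := ℝ) s
  rw [← Real.exp_eq_exp_ℝ, ← hasSum_nat_add_iff' 2] at h
  simpa [Finset.sum_range_succ, sub_sub] using h

theorem convexOn_exp_sub : ConvexOn ℝ Set.univ fun s : ℝ => Real.exp s - 1 - s := by
  have h1 : ConvexOn ℝ Set.univ fun s : ℝ => -1 - s :=
    (convexOn_const (-1) convex_univ).sub (concaveOn_id convex_univ)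
  refine (convexOn_exp.add h1).congr fun s _ => ?_
  simp only [Pi.add_apply]
  ring

theorem exp_sub_mono {s t : ℝ} (hs : 0 ≤ s) (hst : s ≤ t) :
    Real.exp s - 1 - s ≤ Real.exp t - 1 - t :=
  hasSum_le (fun r => by gcongr) (hasSum_exp_sub s) (hasSum_exp_sub t)

/-- For negative `t` this is `s ≤ sinh s` at `s = -t`. -/
theorem exp_sub_le_abs (t : ℝ) : Real.exp t - 1 - t ≤ Real.exp |t| - 1 - |t| := by
  rcases le_total 0 t with h | h
  · rw [abs_of_nonneg h]
  · rw [abs_of_nonpos h]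
    have h1 := Real.self_le_sinh_iff.2 (neg_nonneg.2 h)
    rw [Real.sinh_eq, neg_neg] at h1
    linarith

/-- The Bernstein moment condition for a nonnegative function. -/
structure BernsteinMoments {Y : Type*} [MeasurableSpace Y] (g : Y → ℝ) (σ V : ℝ)
    (ν : Measure Y) : Prop where
  measurable : Measurable g
  nonneg : ∀ y, 0 ≤ g y
  V_nonneg : 0 ≤ V
  moment_le : ∀ r : ℕ, 2 ≤ r →
    ∫⁻ y, ENNReal.ofReal (g y ^ r) ∂ν ≤ ENNReal.ofReal (1 / 2 * σ ^ 2 * r ! * V ^ (r - 2))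

theorem BernsteinMoments.memLp {Y : Type*} [MeasurableSpace Y] {g : Y → ℝ} {σ V : ℝ}
    {ν : Measure Y} (hg : BernsteinMoments g σ V ν) : MemLp g 2 ν := by
  refine (memLp_two_iff_integrable_sq hg.measurable.aestronglyMeasurable).2
    ⟨(hg.measurable.pow_const 2).aestronglyMeasurable, ?_⟩
  rw [hasFiniteIntegral_iff_ofReal (Filter.Eventually.of_forall fun y => sq_nonneg _)]
  exact (hg.moment_le 2 le_rfl).trans_lt ENNReal.ofReal_lt_top

theorem BernsteinMoments.integrable {Y : Type*} [MeasurableSpace Y] {g : Y → ℝ} {σ V : ℝ}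
    {ν : Measure Y} [IsFiniteMeasure ν] (hg : BernsteinMoments g σ V ν) : Integrable g ν :=
  hg.memLp.integrable (by norm_num)

/-- Only powers `r ≥ 2` occur in the series of `exp s - 1 - s`, and the moment condition makes it
geometric of ratio `c * V ≤ 1 / 2`. -/
theorem BernsteinMoments.lintegral_exp_sub_le {Y : Type*} [MeasurableSpace Y] {g : Y → ℝ}
    {σ V c : ℝ} {ν : Measure Y} (hg : BernsteinMoments g σ V ν) (hc : 0 ≤ c) (hcV : c * V ≤ 1 / 2) :
    ∫⁻ y, ENNReal.ofReal (Real.exp (c * g y) - 1 - c * g y) ∂ν ≤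
      ENNReal.ofReal (c ^ 2 * σ ^ 2) := by
  have hgm := hg.measurable
  have e : ∀ y, ENNReal.ofReal (Real.exp (c * g y) - 1 - c * g y) =
      ∑' r : ℕ, ENNReal.ofReal (c ^ (r + 2) / (r + 2)!) * ENNReal.ofReal (g y ^ (r + 2)) := by
    intro y
    have h0 : 0 ≤ c * g y := mul_nonneg hc (hg.nonneg y)
    rw [← (hasSum_exp_sub (c * g y)).tsum_eq, ENNReal.ofReal_tsum_of_nonneg
      (fun r => by positivity) (hasSum_exp_sub _).summable]
    refine tsum_congr fun r => ?_
    rw [← ENNReal.ofReal_mul (by positivity), mul_pow, div_mul_eq_mul_div]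
  simp_rw [e]
  rw [lintegral_tsum fun r => by fun_prop]
  have hs : HasSum (fun l : ℕ => c ^ 2 * σ ^ 2 / 2 * (1 / 2) ^ l) (c ^ 2 * σ ^ 2 / 2 * 2) :=
    hasSum_geometric_two.mul_left _
  have hle : ∀ r : ℕ, ∫⁻ y, ENNReal.ofReal (c ^ (r + 2) / (r + 2)!) *
      ENNReal.ofReal (g y ^ (r + 2)) ∂ν ≤ ENNReal.ofReal (c ^ 2 * σ ^ 2 / 2 * (1 / 2) ^ r) := by
    intro r
    rw [lintegral_const_mul _ (by fun_prop)]
    refine (mul_le_mul_right (hg.moment_le (r + 2) (by omega)) _).trans ?_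
    rw [← ENNReal.ofReal_mul (by positivity)]
    refine ENNReal.ofReal_le_ofReal ?_
    rw [Nat.add_sub_cancel]
    have h1 : (c * V) ^ r ≤ (1 / 2) ^ r := pow_le_pow_left₀ (mul_nonneg hc hg.V_nonneg) hcV r
    have h2 : c ^ (r + 2) / (r + 2)! * (1 / 2 * σ ^ 2 * (r + 2)! * V ^ r) =
        c ^ 2 * σ ^ 2 / 2 * (c * V) ^ r := by
      have : ((r + 2)! : ℝ) ≠ 0 := by positivity
      field_simp
      ring
    rw [h2]
    gcongr
  refine (ENNReal.tsum_le_tsum hle).trans ?_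
  rw [← ENNReal.ofReal_tsum_of_nonneg (fun l => by positivity) hs.summable, hs.tsum_eq]
  exact ENNReal.ofReal_le_ofReal (by linarith)

theorem integrable_of_abs_sub_le {Y : Type*} [MeasurableSpace Y] {ν : Measure Y}
    [IsFiniteMeasure ν] {g h : Y → ℝ} {L : ℝ} (hg : Integrable g ν) (hh : Measurable h)
    (hL : ∀ a b, |h a - h b| ≤ L * (g a + g b)) : Integrable h ν := by
  rcases isEmpty_or_nonempty Y with hY | ⟨⟨b⟩⟩
  · exact Integrable.of_isEmpty
  refine Integrable.mono' (g := fun a => |h b| + L * (g a + g b)) (by fun_prop)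
    hh.aestronglyMeasurable (Filter.Eventually.of_forall fun a => ?_)
  have h1 := abs_sub_abs_le_abs_sub (h a) (h b)
  have h2 := hL a b
  rw [Real.norm_eq_abs]
  linarith

/-- Averaging the hypothesis over `b` bounds `|h - m|` by `L (g + ∫ g)`. In `exp s ≤ 1 + s + φ |s|`,
with `φ u = exp u - 1 - u`, the linear term integrates to zero; convexity of `φ` separates `g` from
its mean, and Jensen reduces the latter to `∫ φ (c g)`. -/
theorem BernsteinMoments.lintegral_exp_le {Y : Type*} [MeasurableSpace Y] {g h : Y → ℝ}
    {σ V t L : ℝ} {ν : Measure Y} [IsProbabilityMeasure ν] (hg : BernsteinMoments g σ V ν)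
    (ht : 0 ≤ t) (hL0 : 0 ≤ L) (htV : 4 * t * L * V ≤ 1) (hh : Measurable h)
    (hL : ∀ a b, |h a - h b| ≤ L * (g a + g b)) :
    ∫⁻ y, ENNReal.ofReal (Real.exp (t * h y)) ∂ν ≤
      ENNReal.ofReal (Real.exp (t * ∫ y, h y ∂ν + 4 * t ^ 2 * L ^ 2 * σ ^ 2)) := by
  have hgi := hg.integrable
  have hgm := hg.measurable
  have hhi := integrable_of_abs_sub_le hgi hh hL
  set m := ∫ y, h y ∂ν with hm
  -- The factor `2` compensates the convexity weights `1 / 2`; the condition `4 t L V ≤ 1` is then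
  -- `c * V ≤ 1 / 2`.
  set c := 2 * t * L with hc
  have hc0 : 0 ≤ c := by positivity
  have hlin := hg.lintegral_exp_sub_le hc0 (by rw [hc]; linarith)
  let ψ : Y → ℝ := fun y => Real.exp (c * g y) - 1 - c * g y
  have hψ0 : ∀ y, 0 ≤ ψ y := fun y => by
    have := Real.add_one_le_exp (c * g y)
    simp only [ψ]
    linarith
  have hψi : Integrable ψ ν := by
    refine ⟨by fun_prop, ?_⟩
    rw [hasFiniteIntegral_iff_ofReal (Filter.Eventually.of_forall hψ0)]
    exact hlin.trans_lt ENNReal.ofReal_lt_top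
  have hψB : ∫ y, ψ y ∂ν ≤ c ^ 2 * σ ^ 2 := by
    rw [integral_eq_lintegral_of_nonneg_ae (Filter.Eventually.of_forall hψ0) (by fun_prop)]
    exact ENNReal.toReal_le_of_le_ofReal (by positivity) hlin
  have hJ : Real.exp (c * ∫ y, g y ∂ν) - 1 - c * ∫ y, g y ∂ν ≤ ∫ y, ψ y ∂ν := by
    have := convexOn_exp_sub.map_integral_le (μ := ν) (f := fun y => c * g y) (by fun_prop)
      isClosed_univ (by simp) (hgi.const_mul c) hψi
    rwa [integral_const_mul] at this
  have hdev : ∀ a, |h a - m| ≤ L * (g a + ∫ y, g y ∂ν) := by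
    intro a
    have e1 : h a - m = ∫ b, (h a - h b) ∂ν := by
      rw [integral_sub (integrable_const _) hhi, integral_const]
      simp [hm]
    have e2 : L * (g a + ∫ y, g y ∂ν) = ∫ b, L * (g a + g b) ∂ν := by
      rw [integral_const_mul, integral_add (integrable_const _) hgi, integral_const]
      simp
    rw [e1, e2, ← Real.norm_eq_abs]
    exact norm_integral_le_of_norm_le (((integrable_const _).add hgi).const_mul L)
      (Filter.Eventually.of_forall fun b => hL a b)
  have hpt : ∀ a, Real.exp (t * (h a - m)) ≤
      1 + t * (h a - m) + (1 / 2 * ψ a + 1 / 2 * ∫ y, ψ y ∂ν) := by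
    intro a
    have h1 := exp_sub_le_abs (t * (h a - m))
    have h2 : |t * (h a - m)| ≤ 1 / 2 * (c * g a) + 1 / 2 * (c * ∫ y, g y ∂ν) := by
      rw [abs_mul, abs_of_nonneg ht]
      calc t * |h a - m| ≤ t * (L * (g a + ∫ y, g y ∂ν)) := by gcongr; exact hdev a
        _ = _ := by rw [hc]; ring
    have h3 := exp_sub_mono (abs_nonneg _) h2
    have h4 := convexOn_exp_sub.2 (Set.mem_univ (c * g a)) (Set.mem_univ (c * ∫ y, g y ∂ν))
      (by norm_num : (0 : ℝ) ≤ 1 / 2) (by norm_num : (0 : ℝ) ≤ 1 / 2) (by norm_num)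
    simp only [smul_eq_mul] at h4
    simp only [ψ] at hJ ⊢
    linarith
  have hbi : Integrable (fun a => 1 + t * (h a - m) + (1 / 2 * ψ a + 1 / 2 * ∫ y, ψ y ∂ν)) ν := by
    fun_prop
  have hei : Integrable (fun a => Real.exp (t * (h a - m))) ν :=
    hbi.mono' (by fun_prop) (Filter.Eventually.of_forall fun a => by
      rw [Real.norm_eq_abs, Real.abs_exp]
      exact hpt a)
  have hint : ∫ a, Real.exp (t * (h a - m)) ∂ν ≤ Real.exp (c ^ 2 * σ ^ 2) := by
    refine (integral_mono hei hbi hpt).trans ?_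
    rw [integral_add (by fun_prop) (by fun_prop), integral_add (by fun_prop) (by fun_prop),
      integral_add (by fun_prop) (by fun_prop), integral_const_mul, integral_const_mul,
      integral_sub hhi (by fun_prop)]
    simp only [integral_const, probReal_univ, one_smul, ← hm, sub_self, mul_zero]
    have := Real.add_one_le_exp (c ^ 2 * σ ^ 2)
    linarith
  have e : ∀ y, ENNReal.ofReal (Real.exp (t * h y)) =
      ENNReal.ofReal (Real.exp (t * m)) * ENNReal.ofReal (Real.exp (t * (h y - m))) := fun y => by
    rw [← ENNReal.ofReal_mul (Real.exp_nonneg _), ← Real.exp_add]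
    ring_nf
  simp_rw [e]
  rw [lintegral_const_mul _ (by fun_prop), ← ofReal_integral_eq_lintegral_ofReal hei
    (Filter.Eventually.of_forall fun y => Real.exp_nonneg _), Real.exp_add,
    ENNReal.ofReal_mul (Real.exp_nonneg _)]
  refine mul_le_mul_right (ENNReal.ofReal_le_ofReal (hint.trans_eq ?_)) _
  rw [hc]
  ring_nf

/-- Exponential moments of a function of independent variables with differences bounded by a
function satisfying the Bernstein moment condition. -/
theorem BernsteinMoments.lintegral_exp_pi_le {Y : Type*} [MeasurableSpace Y] {g : Y → ℝ}
    {σ V t L : ℝ} {ν : Measure Y} [IsProbabilityMeasure ν] (hg : BernsteinMoments g σ V ν)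
    (ht : 0 ≤ t) (hL0 : 0 ≤ L) (htV : 4 * t * L * V ≤ 1) {n : ℕ} {F : (Fin n → Y) → ℝ}
    (hF : Measurable F)
    (hL : ∀ x i a b, |F (Function.update x i a) - F (Function.update x i b)| ≤ L * (g a + g b)) :
    Integrable F (Measure.pi fun _ => ν) ∧
    ∫⁻ y, ENNReal.ofReal (Real.exp (t * F y)) ∂(Measure.pi fun _ => ν) ≤
      ENNReal.ofReal (Real.exp (t * ∫ y, F y ∂(Measure.pi fun _ => ν) +
        n * (4 * t ^ 2 * L ^ 2 * σ ^ 2))) := by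
  have hgi := hg.integrable
  induction n with
  | zero =>
    have hc : F = fun _ => F default := funext fun x => congrArg F (Subsingleton.elim _ _)
    rw [hc]
    exact ⟨integrable_const _, by simp⟩
  | succ n ih =>
    have : Nonempty Y := ν.nonempty_of_neZero
    let a₀ : Y := Classical.arbitrary Y
    have mp := (measurePreserving_piFinSuccAbove (fun _ : Fin (n + 1) => ν) 0).symm
    set e := (MeasurableEquiv.piFinSuccAbove (fun _ : Fin (n + 1) => Y) 0).symm with he
    have hecons : ∀ a y, e (a, y) = Fin.cons a y := fun a y => by
      simp [he, MeasurableEquiv.piFinSuccAbove, Fin.insertNthEquiv]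
    have hFe : Measurable fun q => F (e q) := hF.comp e.measurable
    have h1 : ∀ y a b, |F (e (a, y)) - F (e (b, y))| ≤ L * (g a + g b) := fun y a b => by
      have := hL (Fin.cons a₀ y) 0 a b
      rwa [Fin.update_cons_zero, Fin.update_cons_zero, ← hecons, ← hecons] at this
    have h2 : ∀ a y i s s', |F (e (a, Function.update y i s)) - F (e (a, Function.update y i s'))| ≤
        L * (g s + g s') := fun a y i s s' => by
      have := hL (Fin.cons a y) i.succ s s'
      rwa [← Fin.cons_update, ← Fin.cons_update, ← hecons, ← hecons] at this
    have hsec : ∀ y, Measurable fun a => F (e (a, y)) := fun y =>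
      hFe.comp (measurable_id.prodMk measurable_const)
    have hseci : ∀ y, Integrable (fun a => F (e (a, y))) ν := fun y =>
      integrable_of_abs_sub_le hgi (hsec y) (h1 y)
    -- Freezing the first coordinate at `a₀` reduces integrability to `n` variables, up to an error
    -- controlled by `g`.
    have hFei : Integrable (fun q => F (e q)) (ν.prod (Measure.pi fun _ : Fin n => ν)) := by
      have i1 := (ih (F := fun y => F (e (a₀, y))) (hFe.comp (measurable_const.prodMk measurable_id))
        (h2 a₀)).1
      have i2 : Integrable (fun q : Y × (Fin n → Y) => |F (e (a₀, q.2))| + L * (g q.1 + g a₀))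
          (ν.prod (Measure.pi fun _ : Fin n => ν)) :=
        (i1.abs.comp_snd ν).add (((hgi.comp_fst _).add (integrable_const _)).const_mul L)
      refine i2.mono' hFe.aestronglyMeasurable (Filter.Eventually.of_forall fun q => ?_)
      have h3 := abs_sub_abs_le_abs_sub (F (e (q.1, q.2))) (F (e (a₀, q.2)))
      have h4 := h1 q.2 q.1 a₀
      rw [Real.norm_eq_abs]
      linarith
    -- Averaging over one coordinate preserves the difference bounds in the others, so the induction
    -- hypothesis applies to `G`.
    let G : (Fin n → Y) → ℝ := fun y => ∫ a, F (e (a, y)) ∂ν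
    have hG : Measurable G :=
      (hFe.comp measurable_swap).stronglyMeasurable.integral_prod_right'.measurable
    have hGL : ∀ y i s s', |G (Function.update y i s) - G (Function.update y i s')| ≤
        L * (g s + g s') := by
      intro y i s s'
      simp only [G]
      rw [← integral_sub (hseci _) (hseci _), ← Real.norm_eq_abs]
      refine (norm_integral_le_of_norm_le_const (Filter.Eventually.of_forall fun a =>
        h2 a y i s s')).trans_eq ?_
      simp
    have hFi : Integrable F (Measure.pi fun _ : Fin (n + 1) => ν) :=
      (mp.integrable_comp_emb e.measurableEmbedding).1 hFei
    refine ⟨hFi, ?_⟩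
    have hFG : ∫ y, F y ∂(Measure.pi fun _ : Fin (n + 1) => ν) =
        ∫ y, G y ∂(Measure.pi fun _ : Fin n => ν) := by
      rw [← mp.integral_comp e.measurableEmbedding, integral_prod_symm _ hFei]
    have hmeas : Measurable fun y => ENNReal.ofReal (Real.exp (t * F y)) := by fun_prop
    have hmeas' : Measurable fun q => ENNReal.ofReal (Real.exp (t * F (e q))) :=
      hmeas.comp e.measurable
    rw [← mp.lintegral_comp hmeas, lintegral_prod_symm _ hmeas'.aemeasurable, hFG]
    calc ∫⁻ y, ∫⁻ a, ENNReal.ofReal (Real.exp (t * F (e (a, y)))) ∂ν ∂(Measure.pi fun _ => ν)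
        ≤ ∫⁻ y, ENNReal.ofReal (Real.exp (t * G y)) *
            ENNReal.ofReal (Real.exp (4 * t ^ 2 * L ^ 2 * σ ^ 2)) ∂(Measure.pi fun _ => ν) := by
          refine lintegral_mono fun y => ?_
          rw [← ENNReal.ofReal_mul (Real.exp_nonneg _), ← Real.exp_add]
          exact hg.lintegral_exp_le ht hL0 htV (hsec y) (h1 y)
      _ ≤ ENNReal.ofReal (Real.exp (t * ∫ y, G y ∂(Measure.pi fun _ => ν) +
            n * (4 * t ^ 2 * L ^ 2 * σ ^ 2))) *
            ENNReal.ofReal (Real.exp (4 * t ^ 2 * L ^ 2 * σ ^ 2)) := by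
          rw [lintegral_mul_const _ (by fun_prop)]
          exact mul_le_mul_left (ih hG hGL).2 _
      _ = _ := by
          rw [← ENNReal.ofReal_mul (Real.exp_nonneg _), ← Real.exp_add]
          push_cast
          ring_nf

/-! ### Rates -/

/-- The (normalized) transport cost through a nested partition with `J` levels. -/
def chainCost (p : ℝ) (k n J : ℕ) : ℝ :=
  2 * ((2 : ℝ) ^ J) ^ (-p) +
    ∑ j ∈ Finset.range J, ((2 : ℝ) ^ j) ^ (-p) * ((3 * 2 ^ (j + 1)) ^ k / n : ℝ) ^ (1 / 2 : ℝ)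

/-- The levels form a geometric sum of ratio `2 ^ (k / 2 - p)`: coarse levels dominate for `k < 2
p`, fine ones for `k > 2 p`, and all weigh the same for `k = 2 p`. -/
theorem chainCost_eq {p : ℝ} (k n J : ℕ) :
    chainCost p k n J = 2 * ((2 : ℝ) ^ J) ^ (-p) +
      (6 ^ k / n : ℝ) ^ (1 / 2 : ℝ) * ∑ j ∈ Finset.range J, ((2 : ℝ) ^ (k / 2 - p : ℝ)) ^ j := by
  unfold chainCost
  rw [Finset.mul_sum]
  congr 1
  refine Finset.sum_congr rfl fun j _ => ?_
  have h1 : ((3 * 2 ^ (j + 1)) ^ k / n : ℝ) = (6 ^ k / n) * ((2 : ℝ) ^ j) ^ k := by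
    rw [show (3 * 2 ^ (j + 1) : ℝ) = 6 * 2 ^ j by ring, mul_pow]
    ring
  rw [h1, Real.mul_rpow (by positivity) (by positivity), mul_left_comm, ← Real.rpow_natCast (2 ^ j) k,
    ← Real.rpow_mul (by positivity), ← Real.rpow_add (by positivity), ← Real.rpow_natCast 2 j,
    ← Real.rpow_mul (by norm_num), ← Real.rpow_natCast (2 ^ (k / 2 - p : ℝ)) j,
    ← Real.rpow_mul (by norm_num)]
  congr 2
  ring

/-- The last level dominates. Choosing `6 * 2 ^ J`, not `2 ^ J`, just below `n ^ (1 / k)` absorbs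
the factor `6 ^ k`, so the constant does not depend on `k`. -/
theorem exists_chainCost_le_of_lt {p : ℝ} (hp : 1 ≤ p) :
    ∃ C : ℝ, 0 < C ∧ ∀ k n : ℕ, 2 * p < k → 1 ≤ n →
      ∃ J, chainCost p k n J ≤ C * (n : ℝ) ^ (-(p / k)) := by
  -- The ratio at the least integer above `2 p`, a lower bound for the ratios of all admissible `k`.
  set x₀ : ℝ := (2 : ℝ) ^ ((⌊2 * p⌋₊ + 1 : ℝ) / 2 - p) with hx₀
  have hx₀1 : 1 < x₀ := Real.one_lt_rpow (by norm_num) (by linarith [Nat.lt_floor_add_one (2 * p)])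
  have hpos : 0 < 1 / (x₀ - 1) := by
    have := sub_pos.2 hx₀1
    positivity
  refine ⟨(2 + 1 / (x₀ - 1)) * 12 ^ p, by positivity, fun k n hk hn => ?_⟩
  have hk0 : (0 : ℝ) < k := by linarith
  have hn0 : (0 : ℝ) < n := by exact_mod_cast hn
  set y : ℝ := (n : ℝ) ^ (1 / k : ℝ) with hy
  have hy0 : 0 < y := by positivity
  have hyp : ∀ c : ℝ, 0 < c → (y / c) ^ (-p) = c ^ p * (n : ℝ) ^ (-(p / k)) := by
    intro c hc
    rw [Real.div_rpow hy0.le hc.le, hy, ← Real.rpow_mul hn0.le, Real.rpow_neg hc.le, div_inv_eq_mul,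
      mul_comm]
    congr 2
    ring
  rcases le_total 6 y with h6 | h6
  · obtain ⟨J, hJ1, hJ2⟩ := exists_nat_pow_near ((one_le_div (by norm_num)).2 h6)
      (one_lt_two : (1 : ℝ) < 2)
    refine ⟨J, ?_⟩
    set x : ℝ := (2 : ℝ) ^ (k / 2 - p : ℝ) with hx
    have hxx : x₀ ≤ x := by
      refine Real.rpow_le_rpow_of_exponent_le (by norm_num) ?_
      have : ⌊2 * p⌋₊ + 1 ≤ k := Nat.succ_le_of_lt ((Nat.floor_lt (by linarith)).2 hk)
      have : (⌊2 * p⌋₊ + 1 : ℝ) ≤ k := by exact_mod_cast this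
      linarith
    have hgeom : ∑ j ∈ Finset.range J, x ^ j ≤ 1 / (x₀ - 1) * x ^ J := by
      rw [geom_sum_eq (by linarith : x ≠ 1), div_mul_eq_mul_div, one_mul]
      have : 0 ≤ x ^ J := by positivity
      exact div_le_div₀ this (by linarith) (by linarith) (by linarith)
    have hxJ : (6 ^ k / n : ℝ) ^ (1 / 2 : ℝ) * x ^ J ≤ ((2 : ℝ) ^ J) ^ (-p) := by
      have e : x ^ J = (((2 : ℝ) ^ J) ^ k) ^ (1 / 2 : ℝ) * ((2 : ℝ) ^ J) ^ (-p) := by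
        rw [hx, ← Real.rpow_natCast _ k, ← Real.rpow_mul (by positivity),
          ← Real.rpow_add (by positivity), ← Real.rpow_natCast, ← Real.rpow_mul (by norm_num),
          ← Real.rpow_natCast, ← Real.rpow_mul (by norm_num)]
        congr 1
        ring
      rw [e, ← mul_assoc, ← Real.mul_rpow (by positivity) (by positivity)]
      refine mul_le_of_le_one_left (by positivity) (Real.rpow_le_one (by positivity) ?_ (by norm_num))
      rw [div_mul_eq_mul_div, div_le_one hn0, ← mul_pow]
      have h7 : (6 * 2 ^ J : ℝ) ≤ y := by rwa [le_div_iff₀' (by norm_num)] at hJ1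
      refine (pow_le_pow_left₀ (by positivity) h7 k).trans_eq ?_
      rw [hy, ← Real.rpow_natCast, ← Real.rpow_mul hn0.le, one_div_mul_cancel hk0.ne', Real.rpow_one]
    have hlow : ((2 : ℝ) ^ J) ^ (-p) ≤ 12 ^ p * (n : ℝ) ^ (-(p / k)) := by
      rw [← hyp 12 (by norm_num)]
      refine Real.rpow_le_rpow_of_nonpos (by positivity) ?_ (by linarith)
      rw [pow_succ] at hJ2
      linarith
    rw [chainCost_eq]
    calc 2 * ((2 : ℝ) ^ J) ^ (-p) + (6 ^ k / n : ℝ) ^ (1 / 2 : ℝ) * ∑ j ∈ Finset.range J, x ^ j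
        ≤ 2 * ((2 : ℝ) ^ J) ^ (-p) + (6 ^ k / n : ℝ) ^ (1 / 2 : ℝ) * (1 / (x₀ - 1) * x ^ J) := by
          gcongr
      _ = 2 * ((2 : ℝ) ^ J) ^ (-p) +
            1 / (x₀ - 1) * ((6 ^ k / n : ℝ) ^ (1 / 2 : ℝ) * x ^ J) := by ring
      _ ≤ 2 * ((2 : ℝ) ^ J) ^ (-p) + 1 / (x₀ - 1) * ((2 : ℝ) ^ J) ^ (-p) := by gcongr
      _ = (2 + 1 / (x₀ - 1)) * ((2 : ℝ) ^ J) ^ (-p) := by ring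
      _ ≤ (2 + 1 / (x₀ - 1)) * (12 ^ p * (n : ℝ) ^ (-(p / k))) := by gcongr
      _ = _ := by ring
  -- Here `n ^ (1 / k) ≤ 6`, so the target is bounded below and no chaining is needed.
  · refine ⟨0, ?_⟩
    have h1 : (1 : ℝ) ≤ 12 ^ p * (n : ℝ) ^ (-(p / k)) := by
      rw [← hyp 12 (by norm_num)]
      exact Real.one_le_rpow_of_pos_of_le_one_of_nonpos (by positivity)
        ((div_le_one (by norm_num)).2 (by linarith)) (by linarith)
    rw [chainCost, mul_assoc]
    simp only [pow_zero, Real.one_rpow, Finset.range_zero, Finset.sum_empty]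
    nlinarith

/-- `2 ^ J` is taken just below `n ^ (1 / (2 p))`; the clean bound on `J` uses `p ≥ 1` and `log 2 >
1 / 2`. -/
theorem exists_level {p : ℝ} (hp : 1 ≤ p) {n : ℕ} (hn : 1 ≤ n) :
    ∃ J : ℕ, ((2 : ℝ) ^ J) ^ (-p) ≤ 2 ^ p * (n : ℝ) ^ (-(1 / 2) : ℝ) ∧ (J : ℝ) ≤ Real.log n := by
  have hn1 : (1 : ℝ) ≤ n := by exact_mod_cast hn
  set y : ℝ := (n : ℝ) ^ (1 / (2 * p)) with hy
  have hy1 : 1 ≤ y := Real.one_le_rpow hn1 (by positivity)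
  obtain ⟨J, hJ1, hJ2⟩ := exists_nat_pow_near hy1 (one_lt_two : (1 : ℝ) < 2)
  refine ⟨J, ?_, ?_⟩
  · have e : 2 ^ p * (n : ℝ) ^ (-(1 / 2) : ℝ) = (y / 2) ^ (-p) := by
      rw [Real.div_rpow (by linarith) (by norm_num), hy, ← Real.rpow_mul (by linarith),
        Real.rpow_neg (by norm_num : (0 : ℝ) ≤ 2), div_inv_eq_mul, mul_comm]
      congr 2
      field_simp
    rw [e]
    refine Real.rpow_le_rpow_of_nonpos (by positivity) ?_ (by linarith)
    rw [pow_succ] at hJ2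
    linarith
  · have h := Real.log_le_log (by positivity) hJ1
    rw [Real.log_pow, hy, Real.log_rpow (by linarith)] at h
    have h2 := Real.log_two_gt_d9
    have h3 : 1 / (2 * p) * Real.log n ≤ 1 / 2 * Real.log n := by
      have := Real.log_nonneg hn1
      gcongr
      linarith
    have h4 : (0 : ℝ) ≤ J := by positivity
    nlinarith

theorem exists_chainCost_le_of_gt {p : ℝ} (hp : 1 ≤ p) :
    ∃ C : ℝ, 0 < C ∧ ∀ k n : ℕ, (k : ℝ) < 2 * p → 1 ≤ n →
      ∃ J, chainCost p k n J ≤ C * (n : ℝ) ^ (-(1 / 2) : ℝ) := by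
  -- The ratio at the largest integer below `2 p`, an upper bound for the ratios of all admissible
  -- `k`.
  set x₀ : ℝ := (2 : ℝ) ^ ((⌈2 * p⌉₊ - 1 : ℝ) / 2 - p) with hx₀
  have hx₀1 : x₀ < 1 := Real.rpow_lt_one_of_one_lt_of_neg (by norm_num)
    (by linarith [Nat.ceil_lt_add_one (by linarith : 0 ≤ 2 * p)])
  have hpos : 0 < 1 / (1 - x₀) := by
    have := sub_pos.2 hx₀1
    positivity
  refine ⟨2 * 2 ^ p + 6 ^ p * (1 / (1 - x₀)), by positivity, fun k n hk hn => ?_⟩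
  have hn0 : (0 : ℝ) < n := by exact_mod_cast hn
  obtain ⟨J, hJ, -⟩ := exists_level hp hn
  refine ⟨J, ?_⟩
  rw [chainCost_eq]
  set x : ℝ := (2 : ℝ) ^ (k / 2 - p : ℝ) with hx
  have hx0 : 0 ≤ x := by positivity
  have hxx : x ≤ x₀ := by
    refine Real.rpow_le_rpow_of_exponent_le (by norm_num) ?_
    have : k + 1 ≤ ⌈2 * p⌉₊ := Nat.succ_le_of_lt (Nat.lt_ceil.2 hk)
    have : (k + 1 : ℝ) ≤ ⌈2 * p⌉₊ := by exact_mod_cast this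
    linarith
  have hgeom : ∑ j ∈ Finset.range J, x ^ j ≤ 1 / (1 - x₀) := by
    rw [geom_sum_eq (by linarith : x ≠ 1), ← neg_div_neg_eq]
    have : 0 ≤ x ^ J := by positivity
    exact div_le_div₀ (by norm_num) (by linarith) (by linarith) (by linarith)
  have h6 : (6 ^ k / n : ℝ) ^ (1 / 2 : ℝ) ≤ 6 ^ p * (n : ℝ) ^ (-(1 / 2) : ℝ) := by
    rw [Real.div_rpow (by positivity) hn0.le, Real.rpow_neg hn0.le, ← div_eq_mul_inv,
      ← Real.rpow_natCast, ← Real.rpow_mul (by norm_num)]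
    gcongr
    · norm_num
    · linarith
  calc 2 * ((2 : ℝ) ^ J) ^ (-p) + (6 ^ k / n : ℝ) ^ (1 / 2 : ℝ) * ∑ j ∈ Finset.range J, x ^ j
      ≤ 2 * (2 ^ p * (n : ℝ) ^ (-(1 / 2) : ℝ)) +
          (6 ^ p * (n : ℝ) ^ (-(1 / 2) : ℝ)) * (1 / (1 - x₀)) := by gcongr
    _ = _ := by ring

/-- All levels contribute equally, and their number `J ≤ log n` is the source of the logarithm. -/
theorem exists_chainCost_le_of_eq {p : ℝ} (hp : 1 ≤ p) :
    ∃ C : ℝ, 0 < C ∧ ∀ k n : ℕ, (k : ℝ) = 2 * p → 2 ≤ n →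
      ∃ J, chainCost p k n J ≤ C * ((n : ℝ) ^ (-(1 / 2) : ℝ) * Real.log n) := by
  refine ⟨4 * 2 ^ p + 6 ^ p, by positivity, fun k n hk hn => ?_⟩
  have hn0 : (0 : ℝ) < n := by exact_mod_cast (by omega : 0 < n)
  obtain ⟨J, hJ, hJ'⟩ := exists_level hp (by omega : 1 ≤ n)
  refine ⟨J, ?_⟩
  have hlog : 1 ≤ 2 * Real.log n := by
    have h1 := Real.log_two_gt_d9
    have h2 := Real.log_le_log (by norm_num) (by exact_mod_cast hn : (2 : ℝ) ≤ n)
    linarith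
  have hx : (2 : ℝ) ^ (k / 2 - p : ℝ) = 1 := by
    rw [hk, mul_div_cancel_left₀ _ two_ne_zero, sub_self, Real.rpow_zero]
  have h6 : (6 ^ k / n : ℝ) ^ (1 / 2 : ℝ) = 6 ^ p * (n : ℝ) ^ (-(1 / 2) : ℝ) := by
    rw [Real.div_rpow (by positivity) hn0.le, Real.rpow_neg hn0.le, ← div_eq_mul_inv,
      ← Real.rpow_natCast, ← Real.rpow_mul (by norm_num), hk]
    congr 2
    ring
  rw [chainCost_eq, hx, h6]
  simp only [one_pow, Finset.sum_const, Finset.card_range, nsmul_eq_mul, mul_one]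
  calc 2 * ((2 : ℝ) ^ J) ^ (-p) + 6 ^ p * (n : ℝ) ^ (-(1 / 2) : ℝ) * J
      ≤ 2 * (2 ^ p * (n : ℝ) ^ (-(1 / 2) : ℝ)) * (2 * Real.log n) +
          6 ^ p * (n : ℝ) ^ (-(1 / 2) : ℝ) * Real.log n := by
        refine add_le_add ((mul_le_mul_of_nonneg_left hJ (by norm_num)).trans ?_) (by gcongr)
        exact le_mul_of_one_le_right (by positivity) hlog
    _ = _ := by ring

theorem exists_chainCost_le {p : ℝ} (hp : 1 ≤ p) :
    ∃ C : ℝ, 0 < C ∧ ∀ k n : ℕ, 2 ≤ n → ∃ J, chainCost p k n J ≤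
      C * ((n : ℝ) ^ (-(p / max (2 * p) k)) * if (k : ℝ) = 2 * p then Real.log n else 1) := by
  obtain ⟨C₁, h1, H1⟩ := exists_chainCost_le_of_lt hp
  obtain ⟨C₂, h2, H2⟩ := exists_chainCost_le_of_gt hp
  obtain ⟨C₃, h3, H3⟩ := exists_chainCost_le_of_eq hp
  have hpp : p / (2 * p) = 1 / 2 := by field_simp
  refine ⟨max C₁ (max C₂ C₃), lt_max_of_lt_left h1, fun k n hn => ?_⟩
  rcases lt_trichotomy (k : ℝ) (2 * p) with hk | hk | hk
  · obtain ⟨J, hJ⟩ := H2 k n hk (by omega)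
    refine ⟨J, hJ.trans ?_⟩
    rw [if_neg hk.ne, max_eq_left hk.le, hpp, mul_one]
    gcongr
    exact (le_max_left _ _).trans (le_max_right _ _)
  · obtain ⟨J, hJ⟩ := H3 k n hk hn
    refine ⟨J, hJ.trans ?_⟩
    rw [if_pos hk, max_eq_left hk.le, hpp]
    have := Real.log_natCast_nonneg n
    gcongr
    exact (le_max_right _ _).trans (le_max_right _ _)
  · obtain ⟨J, hJ⟩ := H1 k n hk (by omega)
    refine ⟨J, hJ.trans ?_⟩
    rw [if_neg hk.ne', max_eq_right hk.le, mul_one]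
    gcongr
    exact le_max_left _ _

/-! ### Comparison with the stated rate -/

/-- At `n = 2` the logarithm is below `1`, so its powers can shrink the rate; since `log 2 > 1 / 2`,
they do so by a factor of at most `4`. -/
theorem one_fourth_le_log_rpow {n : ℕ} (hn : 2 ≤ n) {a : ℝ} (ha0 : 0 ≤ a) (ha : a ≤ 2) :
    1 / 4 ≤ Real.log n ^ a := by
  have h1 := Real.log_two_gt_d9
  have h2 := Real.log_le_log (by norm_num) (by exact_mod_cast hn : (2 : ℝ) ≤ n)
  have h3 : (1 / 2 : ℝ) ^ a ≤ Real.log n ^ a := Real.rpow_le_rpow (by norm_num) (by linarith) ha0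
  refine le_trans ?_ h3
  have h4 := Real.rpow_le_rpow_of_exponent_ge (by norm_num : (0 : ℝ) < 1 / 2) (by norm_num) ha
  norm_num at h4 ⊢
  exact h4

theorem zeta_nonneg (p q : ℝ) (k : ℕ) : 0 ≤ zeta p q k := by
  unfold zeta
  split_ifs <;> norm_num

theorem zeta_le_two (p q : ℝ) (k : ℕ) : zeta p q k ≤ 2 := by
  unfold zeta
  split_ifs <;> norm_num

theorem rpow_le_iprwRate {p q : ℝ} (hp : 1 ≤ p) {k n : ℕ} (hn : 2 ≤ n) {a : ℝ}
    (ha : min (1 / max (2 * p) (k : ℝ)) (1 / p - 1 / q) ≤ a) :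
    (n : ℝ) ^ (-a) ≤ 4 * iprwRate p q k n := by
  have hn1 : (1 : ℝ) ≤ n := by exact_mod_cast (by omega : 1 ≤ n)
  have h1 : (n : ℝ) ^ (-a) ≤ (n : ℝ) ^ (-(min (1 / max (2 * p) (k : ℝ)) (1 / p - 1 / q))) :=
    Real.rpow_le_rpow_of_exponent_le hn1 (by linarith)
  have h2 := one_fourth_le_log_rpow hn (a := zeta p q k / p)
    (div_nonneg (zeta_nonneg p q k) (by linarith))
    ((div_le_self (zeta_nonneg p q k) hp).trans (zeta_le_two p q k))
  have h3 : 0 ≤ (n : ℝ) ^ (-a) := by positivity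
  unfold iprwRate
  nlinarith [mul_le_mul h1 h2 (by norm_num) (by positivity)]

theorem inv_le_iprwRate {p q : ℝ} (hp : 1 ≤ p) {k n : ℕ} (hn : 2 ≤ n) :
    (n : ℝ)⁻¹ ≤ 4 * iprwRate p q k n := by
  rw [← Real.rpow_neg_one]
  refine rpow_le_iprwRate hp hn ((min_le_left _ _).trans ?_)
  have : 1 ≤ max (2 * p) (k : ℝ) := le_max_of_le_left (by linarith)
  exact (div_le_one (by linarith)).2 this

/-- Only `k = 2 p` is delicate. For `q < 2 p` the stated rate has no logarithm, but its exponent `1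
/ p - 1 / q` is smaller than `1 / (2 p)` and the gap `n ^ a` absorbs one; for `q ≥ 2 p` one has `ζ ≥
1`. -/
theorem exists_le_iprwRate {p q : ℝ} (hp : 1 ≤ p) (hpq : p ≤ q) :
    ∃ C : ℝ, 0 < C ∧ ∀ k n : ℕ, 2 ≤ n →
      (n : ℝ) ^ (-(1 / max (2 * p) (k : ℝ))) *
        (if (k : ℝ) = 2 * p then Real.log n else 1) ^ (1 / p) ≤ C * iprwRate p q k n := by
  have hp0 : 0 < p := by linarith
  have hq0 : 0 < q := by linarith
  set a := 1 / q - 1 / (2 * p) with ha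
  refine ⟨4 + 4 * (if 0 < a then 1 / (a * p) ^ (1 / p) else 1), ?_, fun k n hn => ?_⟩
  · split_ifs <;> positivity
  have hn0 : (0 : ℝ) < n := by exact_mod_cast (by omega : 0 < n)
  have hlog : 0 < Real.log n := Real.log_pos (by exact_mod_cast (by omega : 1 < n))
  have hI : 0 ≤ iprwRate p q k n := by
    unfold iprwRate
    positivity
  have hc : 0 ≤ (if 0 < a then 1 / (a * p) ^ (1 / p) else 1) := by
    split_ifs <;> positivity
  have hweak : ∀ y, y ≤ 4 * iprwRate p q k n →
      y ≤ (4 + 4 * (if 0 < a then 1 / (a * p) ^ (1 / p) else 1)) * iprwRate p q k n := by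
    intro y hy
    nlinarith [mul_nonneg hc hI]
  by_cases hk : (k : ℝ) = 2 * p
  swap
  · rw [if_neg hk, Real.one_rpow, mul_one]
    exact hweak _ (rpow_le_iprwRate hp hn (min_le_left _ _))
  rw [if_pos hk]
  rcases lt_or_ge q (2 * p) with hq | hq
  · have ha0 : 0 < a := sub_pos.2 (one_div_lt_one_div_of_lt hq0 hq)
    have h1 : Real.log n ^ (1 / p) ≤ 1 / (a * p) ^ (1 / p) * (n : ℝ) ^ a := by
      have h2 := Real.rpow_le_rpow hlog.le
        (Real.log_le_rpow_div hn0.le (by positivity : 0 < a * p)) (by positivity : 0 ≤ 1 / p)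
      rw [one_div_mul_eq_div]
      rwa [Real.div_rpow (by positivity) (by positivity), ← Real.rpow_mul hn0.le, mul_assoc,
        mul_one_div_cancel hp0.ne', mul_one] at h2
    rw [if_pos ha0]
    have h3 := rpow_le_iprwRate (q := q) (k := k) hp hn (min_le_right _ (1 / p - 1 / q))
    have h4 : (n : ℝ) ^ (-(1 / max (2 * p) (k : ℝ))) * (n : ℝ) ^ a = (n : ℝ) ^ (-(1 / p - 1 / q)) := by
      rw [← Real.rpow_add hn0, hk, max_self, ha]
      congr 1
      field_simp
      ring
    calc (n : ℝ) ^ (-(1 / max (2 * p) (k : ℝ))) * Real.log n ^ (1 / p)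
        ≤ (n : ℝ) ^ (-(1 / max (2 * p) (k : ℝ))) * (1 / (a * p) ^ (1 / p) * (n : ℝ) ^ a) := by
          gcongr
      _ = 1 / (a * p) ^ (1 / p) * (n : ℝ) ^ (-(1 / p - 1 / q)) := by rw [← h4]; ring
      _ ≤ 1 / (a * p) ^ (1 / p) * (4 * iprwRate p q k n) := by gcongr
      _ ≤ _ := by nlinarith
  · refine hweak _ ?_
    have hζ : 1 ≤ zeta p q k := by
      unfold zeta
      rcases hq.eq_or_lt with hq | hq
      · rw [if_pos ⟨hk, hq.symm⟩]
        norm_num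
      · rw [if_neg (fun h => hq.ne' h.2), if_pos (Or.inr ⟨hk, hk ▸ hq⟩)]
    have h1 : Real.log n ^ (1 / p) ≤ 4 * Real.log n ^ (zeta p q k / p) := by
      have e : zeta p q k / p = 1 / p + (zeta p q k - 1) / p := by ring
      have h2 := one_fourth_le_log_rpow hn (a := (zeta p q k - 1) / p)
        (div_nonneg (by linarith) hp0.le)
        ((div_le_self (by linarith) hp).trans (by linarith [zeta_le_two p q k]))
      rw [e, Real.rpow_add hlog]
      have h3 : 0 < Real.log n ^ (1 / p) := by positivity
      nlinarith
    have h2 : (n : ℝ) ^ (-(1 / max (2 * p) (k : ℝ))) ≤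
        (n : ℝ) ^ (-(min (1 / max (2 * p) (k : ℝ)) (1 / p - 1 / q))) :=
      Real.rpow_le_rpow_of_exponent_le (by exact_mod_cast (by omega : 1 ≤ n))
        (neg_le_neg (min_le_left _ _))
    unfold iprwRate
    calc _ ≤ (n : ℝ) ^ (-(min (1 / max (2 * p) (k : ℝ)) (1 / p - 1 / q))) *
          (4 * Real.log n ^ (zeta p q k / p)) := by gcongr
      _ = _ := by ring

/-! ### Mean and concentration of the Wasserstein distance to the empirical measure -/

/-- Only the moment of order `r = ⌈2 p + 2⌉` is used, so `r !` is a constant depending on `p`; the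
`p`-th root turns the rate of the cost into that of the distance. -/
theorem exists_mean_bound {p : ℝ} (hp : 1 ≤ p) :
    ∃ C : ℝ, 0 < C ∧ ∀ (k n : ℕ), 2 ≤ n → ∀ R : ℝ, 0 < R →
      ∀ (ν : Measure (EuclideanSpace ℝ (Fin k))) [IsProbabilityMeasure ν],
      (∀ r : ℕ, 2 ≤ r → ∫⁻ y, ‖y‖ₑ ^ r ∂ν ≤ ENNReal.ofReal (r ! * R ^ r)) →
      ∫⁻ y, wasserstein p (empirical y) ν ∂(Measure.pi fun _ : Fin n => ν) ≤
        ENNReal.ofReal (C * R * ((n : ℝ) ^ (-(1 / max (2 * p) (k : ℝ))) *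
          (if (k : ℝ) = 2 * p then Real.log n else 1) ^ (1 / p))) := by
  obtain ⟨C, hC, H⟩ := exists_chainCost_le hp
  have hp0 : 0 < p := by linarith
  set r : ℕ := ⌈2 * p + 2⌉₊ with hr
  have hr2 : 2 ≤ r := by
    have : (2 : ℝ) ≤ r := le_trans (by linarith) (Nat.le_ceil (2 * p + 2))
    exact_mod_cast this
  refine ⟨(2 * (r ! * 2 ^ r)) ^ (1 / p) * (4 * C ^ (1 / p)), by positivity,
    fun k n hn R hR ν _ hν => ?_⟩
  obtain ⟨J, hJ⟩ := H k n hn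
  have hn0 : (0 : ℝ) < n := by exact_mod_cast (by omega : 0 < n)
  set l : ℝ := if (k : ℝ) = 2 * p then Real.log n else 1 with hl
  have hl0 : 0 ≤ l := by
    rw [hl]
    split_ifs
    · exact Real.log_natCast_nonneg n
    · exact zero_le_one
  have hD : (1 : ℝ) ≤ r ! := by exact_mod_cast Nat.one_le_iff_ne_zero.2 (Nat.factorial_ne_zero r)
  refine (lintegral_wasserstein_empirical_le J hp (Nat.le_ceil _) hR hD (by omega) ν
    (hν r hr2)).trans ?_
  have hD0 : (0 : ℝ) < 2 * (r ! * 2 ^ r) := by positivity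
  generalize 2 * ((r ! : ℝ) * 2 ^ r) = D at hD0 ⊢
  have hcell : ∀ j, cellScale p R j = ENNReal.ofReal ((4 * R) ^ p * ((2 : ℝ) ^ j) ^ (-p)) := by
    intro j
    unfold cellScale
    rw [Real.div_rpow (by positivity) (by positivity), Real.rpow_neg (by positivity),
      div_eq_mul_inv]
  have hsum : ENNReal.ofReal D * (2 * cellScale p R J +
      ∑ j ∈ Finset.range J, cellScale p R j *
        ENNReal.ofReal ((3 * 2 ^ (j + 1)) ^ k / n) ^ (1 / 2 : ℝ)) =
      ENNReal.ofReal (D * ((4 * R) ^ p * chainCost p k n J)) := by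
    rw [ENNReal.ofReal_mul hD0.le]
    congr 1
    have e : ∀ j, cellScale p R j * ENNReal.ofReal ((3 * 2 ^ (j + 1)) ^ k / n) ^ (1 / 2 : ℝ) =
        ENNReal.ofReal ((4 * R) ^ p * (((2 : ℝ) ^ j) ^ (-p) *
          ((3 * 2 ^ (j + 1)) ^ k / n : ℝ) ^ (1 / 2 : ℝ))) := fun j => by
      rw [hcell, ENNReal.ofReal_rpow_of_nonneg (by positivity) (by norm_num),
        ← ENNReal.ofReal_mul (by positivity), mul_assoc]
    simp_rw [e]
    rw [← ENNReal.ofReal_sum_of_nonneg fun j _ => by positivity, hcell,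
      ← ENNReal.ofReal_ofNat 2, ← ENNReal.ofReal_mul (by norm_num),
      ← ENNReal.ofReal_add (by positivity) (by positivity), chainCost, mul_add, Finset.mul_sum]
    congr 2
    ring
  have hcc : 0 ≤ chainCost p k n J := by
    unfold chainCost
    positivity
  rw [hsum, ENNReal.ofReal_rpow_of_nonneg (by positivity) (by positivity)]
  refine ENNReal.ofReal_le_ofReal ?_
  calc (D * ((4 * R) ^ p * chainCost p k n J)) ^ (1 / p)
      ≤ (D * ((4 * R) ^ p *
          (C * ((n : ℝ) ^ (-(p / max (2 * p) k)) * l)))) ^ (1 / p) := by gcongr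
    _ = D ^ (1 / p) * (((4 * R) ^ p) ^ (1 / p) *
          (C ^ (1 / p) * (((n : ℝ) ^ (-(p / max (2 * p) k))) ^ (1 / p) * l ^ (1 / p)))) := by
        rw [Real.mul_rpow hD0.le (by positivity),
          Real.mul_rpow (x := (4 * R) ^ p) (by positivity) (by positivity),
          Real.mul_rpow hC.le (by positivity), Real.mul_rpow (by positivity) hl0]
    _ = _ := by
        have e1 : ((4 * R) ^ p) ^ (1 / p) = 4 * R := by
          rw [← Real.rpow_mul (by positivity), mul_one_div_cancel hp0.ne', Real.rpow_one]
        have e2 : ((n : ℝ) ^ (-(p / max (2 * p) k))) ^ (1 / p) =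
            (n : ℝ) ^ (-(1 / max (2 * p) (k : ℝ))) := by
          rw [← Real.rpow_mul hn0.le]
          congr 1
          field_simp
        rw [e1, e2]
        ring

/-! ### Dependence on the sample and concentration -/

theorem rpow_mul_rpow_inv {p : ℝ} (hp : 1 ≤ p) (a b : ℝ≥0∞) :
    (a * b ^ p) ^ (1 / p) = a ^ (1 / p) * b := by
  have hp0 : 0 < p := by linarith
  rw [ENNReal.mul_rpow_of_nonneg _ _ (by positivity), ← ENNReal.rpow_mul,
    mul_one_div_cancel hp0.ne', ENNReal.rpow_one]

theorem wasserstein_empirical_empirical_le_enorm {m n : ℕ} {p : ℝ} (hp : 1 ≤ p) (hn : 1 ≤ n)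
    (x y : Fin n → EuclideanSpace ℝ (Fin m)) :
    wasserstein p (empirical x) (empirical y) ≤ ‖x - y‖ₑ := by
  refine (wasserstein_empirical_empirical_le hp x y).trans ?_
  have hn0 : (n : ℝ≥0∞) ≠ 0 := by exact_mod_cast (by omega : n ≠ 0)
  calc ((n : ℝ≥0∞)⁻¹ * ∑ i, ‖x i - y i‖ₑ ^ p) ^ (1 / p)
      ≤ ((n : ℝ≥0∞)⁻¹ * ∑ _i : Fin n, ‖x - y‖ₑ ^ p) ^ (1 / p) := by
        have hp0 : 0 ≤ p := by linarith
        gcongr with i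
        rw [enorm_le_iff_norm_le]
        exact norm_le_pi_norm (x - y) i
    _ = ‖x - y‖ₑ := by
        rw [Finset.sum_const, Finset.card_univ, Fintype.card_fin, nsmul_eq_mul, ← mul_assoc,
          ENNReal.inv_mul_cancel hn0 (by simp), rpow_mul_rpow_inv hp, ENNReal.one_rpow, one_mul]

/-- Only the mass `1 / n` of one point moves, whence the factor `n ^ (-1 / p)`. -/
theorem wasserstein_empirical_update_le {m n : ℕ} {p : ℝ} (hp : 1 ≤ p)
    (x : Fin n → EuclideanSpace ℝ (Fin m)) (i : Fin n) (a b : EuclideanSpace ℝ (Fin m)) :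
    wasserstein p (empirical (Function.update x i a)) (empirical (Function.update x i b)) ≤
      ((n : ℝ≥0∞)⁻¹) ^ (1 / p) * ‖a - b‖ₑ := by
  refine (wasserstein_empirical_empirical_le hp _ _).trans ?_
  rw [Finset.sum_eq_single i]
  · rw [Function.update_self, Function.update_self, rpow_mul_rpow_inv hp]
  · intro j _ hj
    rw [Function.update_of_ne hj, Function.update_of_ne hj, sub_self, enorm_zero,
      ENNReal.zero_rpow_of_pos (by linarith)]
  · simp

/-- Comparison of `μ` with the Dirac mass at `0`. -/
theorem wasserstein_empirical_map_le {α : Type*} [MeasurableSpace α] {m n : ℕ} {p : ℝ} (hp : 1 ≤ p)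
    (hn : 1 ≤ n) (μ : Measure α) [IsProbabilityMeasure μ] {f : α → EuclideanSpace ℝ (Fin m)}
    (hf : Measurable f) (z : Fin n → EuclideanSpace ℝ (Fin m)) :
    wasserstein p (empirical z) (μ.map f) ≤
      ((n : ℝ≥0∞)⁻¹ * ∑ i, ‖z i‖ₑ ^ p) ^ (1 / p) + (∫⁻ x, ‖f x‖ₑ ^ p ∂μ) ^ (1 / p) := by
  have hn0 : (n : ℝ≥0∞) ≠ 0 := by exact_mod_cast (by omega : n ≠ 0)
  have := isProbabilityMeasure_empirical hn z
  have e : empirical (0 : Fin n → EuclideanSpace ℝ (Fin m)) = μ.map fun _ => 0 := by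
    rw [Measure.map_const, measure_univ, one_smul, empirical]
    simp only [Pi.zero_apply, Finset.sum_const, Finset.card_univ, Fintype.card_fin]
    rw [← Nat.cast_smul_eq_nsmul ℝ≥0∞, smul_smul, ENNReal.inv_mul_cancel hn0 (by simp), one_smul]
  have h1 := wasserstein_empirical_empirical_le hp z 0
  have h2 := wasserstein_map_map_le hp μ (measurable_const (a := (0 : EuclideanSpace ℝ (Fin m)))) hf
  have : IsProbabilityMeasure (empirical (0 : Fin n → EuclideanSpace ℝ (Fin m))) :=
    isProbabilityMeasure_empirical hn 0
  refine (wasserstein_triangle hp _ (empirical (0 : Fin n → EuclideanSpace ℝ (Fin m))) _).trans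
    (add_le_add ?_ ?_)
  · simpa using h1
  · rw [e]
    simpa using h2

theorem wasserstein_empirical_ne_top {m n : ℕ} {p : ℝ} (hp : 1 ≤ p) (hn : 1 ≤ n)
    {ν : Measure (EuclideanSpace ℝ (Fin m))} [IsProbabilityMeasure ν]
    (hν : ∫⁻ y, ‖y‖ₑ ^ p ∂ν ≠ ⊤) (z : Fin n → EuclideanSpace ℝ (Fin m)) :
    wasserstein p (empirical z) ν ≠ ⊤ := by
  have h := wasserstein_empirical_map_le hp hn ν measurable_id z
  rw [Measure.map_id] at h
  have hn0 : (n : ℝ≥0∞) ≠ 0 := by exact_mod_cast (by omega : n ≠ 0)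
  refine ne_top_of_le_ne_top (ENNReal.add_ne_top.2 ⟨?_, ?_⟩) h
  · refine ENNReal.rpow_ne_top_of_nonneg (by positivity) (ENNReal.mul_ne_top (by simpa using hn0) ?_)
    exact ENNReal.sum_ne_top.2 fun i _ => ENNReal.rpow_ne_top_of_nonneg (by linarith) (by simp)
  · exact ENNReal.rpow_ne_top_of_nonneg (by positivity) hν

/-- The Wasserstein distance between an empirical measure and a fixed measure, as a real function
of the sample. -/
def sampleDist {m : ℕ} (p : ℝ) (ν : Measure (EuclideanSpace ℝ (Fin m))) {n : ℕ}
    (z : Fin n → EuclideanSpace ℝ (Fin m)) : ℝ := (wasserstein p (empirical z) ν).toReal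

theorem abs_sampleDist_sub_le {m n : ℕ} {p : ℝ} (hp : 1 ≤ p) (hn : 1 ≤ n)
    {ν : Measure (EuclideanSpace ℝ (Fin m))} [IsProbabilityMeasure ν]
    (hν : ∫⁻ y, ‖y‖ₑ ^ p ∂ν ≠ ⊤) (z z' : Fin n → EuclideanSpace ℝ (Fin m)) {c : ℝ} (hc : 0 ≤ c)
    (h : wasserstein p (empirical z) (empirical z') ≤ ENNReal.ofReal c) :
    |sampleDist p ν z - sampleDist p ν z'| ≤ c := by
  have key : ∀ z z' : Fin n → EuclideanSpace ℝ (Fin m),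
      wasserstein p (empirical z) (empirical z') ≤ ENNReal.ofReal c →
      sampleDist p ν z - sampleDist p ν z' ≤ c := by
    intro z z' h
    have := isProbabilityMeasure_empirical hn z
    have := isProbabilityMeasure_empirical hn z'
    have h1 := (wasserstein_triangle hp (empirical z) (empirical z') ν).trans (add_le_add_left h _)
    have h2 := ENNReal.toReal_mono (ENNReal.add_ne_top.2
      ⟨ENNReal.ofReal_ne_top, wasserstein_empirical_ne_top hp hn hν z'⟩) h1
    rw [ENNReal.toReal_add ENNReal.ofReal_ne_top (wasserstein_empirical_ne_top hp hn hν z'),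
      ENNReal.toReal_ofReal hc] at h2
    unfold sampleDist
    linarith
  rw [abs_le]
  have h1 := key z z' h
  have h2 := key z' z (by rwa [wasserstein_comm])
  constructor <;> linarith

theorem continuous_sampleDist {m n : ℕ} {p : ℝ} (hp : 1 ≤ p) (hn : 1 ≤ n)
    {ν : Measure (EuclideanSpace ℝ (Fin m))} [IsProbabilityMeasure ν]
    (hν : ∫⁻ y, ‖y‖ₑ ^ p ∂ν ≠ ⊤) :
    Continuous (sampleDist p ν : (Fin n → EuclideanSpace ℝ (Fin m)) → ℝ) := by
  have : LipschitzWith 1 (sampleDist p ν : (Fin n → EuclideanSpace ℝ (Fin m)) → ℝ) := by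
    refine LipschitzWith.of_dist_le_mul fun z z' => ?_
    rw [Real.dist_eq, NNReal.coe_one, one_mul, dist_eq_norm]
    refine abs_sampleDist_sub_le hp hn hν z z' (norm_nonneg _) ?_
    rw [ofReal_norm]
    exact wasserstein_empirical_empirical_le_enorm hp hn z z'
  exact this.continuous

/-- Exponential moments of the Wasserstein distance to the empirical measure. -/
theorem lintegral_exp_sampleDist_le {m n : ℕ} {p σ V t M : ℝ} (hp : 1 ≤ p) (hn : 1 ≤ n)
    {ν : Measure (EuclideanSpace ℝ (Fin m))} [IsProbabilityMeasure ν]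
    (hν : ∫⁻ y, ‖y‖ₑ ^ p ∂ν ≠ ⊤) (hg : BernsteinMoments (fun y => ‖y‖) σ V ν)
    (ht : 0 ≤ t) (htV : 4 * t * (n : ℝ) ^ (-(1 / p)) * V ≤ 1) (hM0 : 0 ≤ M)
    (hM : ∫⁻ y, wasserstein p (empirical y) ν ∂(Measure.pi fun _ : Fin n => ν) ≤
      ENNReal.ofReal M) :
    ∫⁻ y, ENNReal.ofReal (Real.exp (t * sampleDist p ν y)) ∂(Measure.pi fun _ : Fin n => ν) ≤
      ENNReal.ofReal (Real.exp (t * M + n * (4 * t ^ 2 * ((n : ℝ) ^ (-(1 / p))) ^ 2 * σ ^ 2))) := by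
  have hn0 : (0 : ℝ) < n := by exact_mod_cast hn
  have hms := (continuous_sampleDist (n := n) hp hn hν).measurable
  have hL : ∀ (x : Fin n → EuclideanSpace ℝ (Fin m)) i a b,
      |sampleDist p ν (Function.update x i a) - sampleDist p ν (Function.update x i b)| ≤
        (n : ℝ) ^ (-(1 / p)) * (‖a‖ + ‖b‖) := by
    intro x i a b
    refine abs_sampleDist_sub_le hp hn hν _ _ (by positivity) ?_
    refine (wasserstein_empirical_update_le hp x i a b).trans ?_
    rw [ENNReal.ofReal_mul (by positivity), Real.rpow_neg hn0.le, ← Real.inv_rpow hn0.le,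
      ← ENNReal.ofReal_rpow_of_pos (by positivity), ENNReal.ofReal_inv_of_pos hn0,
      ENNReal.ofReal_natCast, ← ofReal_norm]
    gcongr
    exact norm_sub_le a b
  have h := (hg.lintegral_exp_pi_le ht (by positivity) htV hms hL).2
  refine h.trans (ENNReal.ofReal_le_ofReal (Real.exp_le_exp.2 ?_))
  have hint : ∫ y, sampleDist p ν y ∂(Measure.pi fun _ : Fin n => ν) ≤ M := by
    rw [integral_eq_lintegral_of_nonneg_ae (f := sampleDist p ν) (Filter.Eventually.of_forall fun y =>
      ENNReal.toReal_nonneg) hms.aestronglyMeasurable]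
    refine ENNReal.toReal_le_of_le_ofReal hM0 (le_trans (lintegral_mono fun y => ?_) hM)
    exact ENNReal.ofReal_toReal_le
  gcongr

/-! ### The projection robust Wasserstein distance -/

theorem ProjBernsteinTail.bernsteinMoments {d k : ℕ} {σ V : ℝ}
    {μ : Measure (EuclideanSpace ℝ (Fin d))} (h : ProjBernsteinTail k σ V μ)
    {E : Matrix (Fin d) (Fin k) ℝ} (hE : E ∈ stiefel d k) :
    BernsteinMoments (fun y => ‖y‖) σ V (μ.map (proj E)) where
  measurable := measurable_norm
  nonneg := norm_nonneg
  V_nonneg := h.V_pos.le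
  moment_le r hr := by
    simp_rw [fun y : EuclideanSpace ℝ (Fin k) => ENNReal.ofReal_pow (norm_nonneg y) r, ofReal_norm]
    exact h.moment_le E hE r hr

theorem ProjBernsteinTail.moment_le_pow {d k : ℕ} {σ V : ℝ}
    {μ : Measure (EuclideanSpace ℝ (Fin d))} (h : ProjBernsteinTail k σ V μ)
    {E : Matrix (Fin d) (Fin k) ℝ} (hE : E ∈ stiefel d k) {r : ℕ} (hr : 2 ≤ r) :
    ∫⁻ y, ‖y‖ₑ ^ r ∂(μ.map (proj E)) ≤ ENNReal.ofReal (r ! * (σ + V) ^ r) := by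
  refine (h.moment_le E hE r hr).trans (ENNReal.ofReal_le_ofReal ?_)
  have hσ := h.sigma_pos
  have hV := h.V_pos
  have h1 : σ ^ 2 * V ^ (r - 2) ≤ (σ + V) ^ r := by
    conv_rhs => rw [← Nat.add_sub_cancel' hr, pow_add]
    gcongr <;> linarith
  calc 1 / 2 * σ ^ 2 * r ! * V ^ (r - 2) = 1 / 2 * (r ! * (σ ^ 2 * V ^ (r - 2))) := by ring
    _ ≤ 1 * (r ! * (σ + V) ^ r) := by gcongr; norm_num
    _ = _ := one_mul _

/-- `(∫ ‖x‖ ^ p dμ) ^ (1 / p)`. -/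
def momentNorm {d : ℕ} (p : ℝ) (μ : Measure (EuclideanSpace ℝ (Fin d))) : ℝ≥0∞ :=
  absMoment p μ ^ (1 / p)

theorem momentNorm_mono {d : ℕ} {p q : ℝ} (hp : 1 ≤ p) (hpq : p ≤ q)
    (μ : Measure (EuclideanSpace ℝ (Fin d))) [IsProbabilityMeasure μ] :
    momentNorm p μ ≤ momentNorm q μ :=
  eLpNorm'_le_eLpNorm'_of_exponent_le (f := id) (by linarith) hpq μ
    measurable_id.aestronglyMeasurable

theorem lintegral_enorm_proj_rpow_le {d k : ℕ} {p : ℝ} (hp : 1 ≤ p)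
    (μ : Measure (EuclideanSpace ℝ (Fin d))) {E : Matrix (Fin d) (Fin k) ℝ} (hE : E ∈ stiefel d k) :
    ∫⁻ x, ‖proj E x‖ₑ ^ p ∂μ ≤ absMoment p μ := by
  have hp0 : 0 ≤ p := by linarith
  unfold absMoment
  gcongr with x
  rw [enorm_le_iff_norm_le]
  exact norm_proj_le hE x

theorem lintegral_map_proj_ne_top {d k : ℕ} {p : ℝ} (hp : 1 ≤ p)
    {μ : Measure (EuclideanSpace ℝ (Fin d))} (hfin : absMoment p μ ≠ ⊤)
    {E : Matrix (Fin d) (Fin k) ℝ} (hE : E ∈ stiefel d k) :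
    ∫⁻ y, ‖y‖ₑ ^ p ∂(μ.map (proj E)) ≠ ⊤ := by
  rw [lintegral_map (by fun_prop) (measurable_proj E)]
  exact ne_top_of_le_ne_top hfin (lintegral_enorm_proj_rpow_le hp μ hE)

/-- The supremum is uncountable, but a supremum of continuous functions of the sample is lower
semicontinuous. -/
theorem measurable_prw_empirical {d k n : ℕ} {p : ℝ} (hp : 1 ≤ p) (hn : 1 ≤ n)
    (μ : Measure (EuclideanSpace ℝ (Fin d))) [IsProbabilityMeasure μ] (hfin : absMoment p μ ≠ ⊤) :
    Measurable fun x : Fin n → EuclideanSpace ℝ (Fin d) => prw p k (empirical x) μ := by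
  refine (lowerSemicontinuous_biSup fun E hE => Continuous.lowerSemicontinuous ?_).measurable
  have hprob : IsProbabilityMeasure (μ.map (proj E)) :=
    Measure.isProbabilityMeasure_map (measurable_proj E).aemeasurable
  have hfinE := lintegral_map_proj_ne_top hp hfin hE
  have e : ∀ x : Fin n → EuclideanSpace ℝ (Fin d),
      wasserstein p ((empirical x).map (proj E)) (μ.map (proj E)) =
        ENNReal.ofReal (sampleDist p (μ.map (proj E)) fun i => proj E (x i)) := fun x => by
    rw [empirical_map x (measurable_proj E), sampleDist,
      ENNReal.ofReal_toReal (wasserstein_empirical_ne_top hp hn hfinE _)]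
  simp_rw [e]
  exact ENNReal.continuous_ofReal.comp ((continuous_sampleDist hp hn hfinE).comp
    (continuous_pi fun i => (continuous_proj E).comp (continuous_apply i)))

/-- The norm of the sample, in the normalized `ℓ^p` sense. -/
def sampleNorm {d n : ℕ} (p : ℝ) (x : Fin n → EuclideanSpace ℝ (Fin d)) : ℝ≥0∞ :=
  ((n : ℝ≥0∞)⁻¹ * ∑ i, ‖x i‖ₑ ^ p) ^ (1 / p)

theorem measurable_sampleNorm {d n : ℕ} (p : ℝ) :
    Measurable (sampleNorm p : (Fin n → EuclideanSpace ℝ (Fin d)) → ℝ≥0∞) := by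
  unfold sampleNorm
  fun_prop

theorem lintegral_sampleNorm_le {d n : ℕ} {p : ℝ} (hp : 1 ≤ p) (hn : 1 ≤ n)
    (μ : Measure (EuclideanSpace ℝ (Fin d))) [IsProbabilityMeasure μ] :
    ∫⁻ x, sampleNorm p x ∂(Measure.pi fun _ : Fin n => μ) ≤ momentNorm p μ := by
  refine (lintegral_rpow_inv_le hp (by fun_prop : Measurable _).aemeasurable).trans_eq ?_
  have h : ∀ x : Fin n → EuclideanSpace ℝ (Fin d), (n : ℝ≥0∞)⁻¹ * ∑ i, ‖x i‖ₑ ^ p =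
      ∫⁻ y, ‖y‖ₑ ^ p ∂(empirical x) := fun x =>
    (lintegral_empirical x (f := fun y => ‖y‖ₑ ^ p) (by fun_prop)).symm
  simp_rw [h]
  rw [lintegral_lintegral_empirical hn μ (by fun_prop)]
  rfl

theorem prw_empirical_le {d k n : ℕ} {p : ℝ} (hp : 1 ≤ p) (hn : 1 ≤ n)
    (μ : Measure (EuclideanSpace ℝ (Fin d))) [IsProbabilityMeasure μ]
    (x : Fin n → EuclideanSpace ℝ (Fin d)) :
    prw p k (empirical x) μ ≤ sampleNorm p x + momentNorm p μ := by
  have hp0 : 0 ≤ p := by linarith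
  refine iSup₂_le fun E hE => ?_
  rw [empirical_map x (measurable_proj E)]
  refine (wasserstein_empirical_map_le hp hn μ (measurable_proj E) _).trans (add_le_add ?_ ?_)
  · unfold sampleNorm
    gcongr with i
    rw [enorm_le_iff_norm_le]
    exact norm_proj_le hE (x i)
  · exact ENNReal.rpow_le_rpow (lintegral_enorm_proj_rpow_le hp μ hE) (by positivity)

/-- Replacing a projection by a nearby one. -/
theorem wasserstein_proj_le {d k n : ℕ} {p ε : ℝ} (hp : 1 ≤ p) (hn : 1 ≤ n) (hε : 0 ≤ ε)
    (μ : Measure (EuclideanSpace ℝ (Fin d))) [IsProbabilityMeasure μ]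
    {E F : Matrix (Fin d) (Fin k) ℝ} (h : ∀ x, ‖proj E x - proj F x‖ ≤ ε * ‖x‖)
    (x : Fin n → EuclideanSpace ℝ (Fin d)) :
    wasserstein p ((empirical x).map (proj E)) (μ.map (proj E)) ≤
      wasserstein p (empirical fun i => proj F (x i)) (μ.map (proj F)) +
        ENNReal.ofReal ε * (sampleNorm p x + momentNorm p μ) := by
  have hp0 : 0 ≤ p := by linarith
  have hE := measurable_proj E
  have hF := measurable_proj F
  have h' : ∀ x, ‖proj E x - proj F x‖ₑ ^ p ≤ ENNReal.ofReal ε ^ p * ‖x‖ₑ ^ p := fun x => by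
    rw [← ENNReal.mul_rpow_of_nonneg _ _ hp0, ← ofReal_norm, ← ofReal_norm,
      ← ENNReal.ofReal_mul hε]
    exact ENNReal.rpow_le_rpow (ENNReal.ofReal_le_ofReal (h x)) hp0
  have e := empirical_map x hE
  have := isProbabilityMeasure_empirical hn fun i => proj E (x i)
  have := isProbabilityMeasure_empirical hn fun i => proj F (x i)
  have : IsProbabilityMeasure (μ.map (proj F)) := Measure.isProbabilityMeasure_map hF.aemeasurable
  have h1 : wasserstein p (empirical fun i => proj E (x i)) (empirical fun i => proj F (x i)) ≤
      ENNReal.ofReal ε * sampleNorm p x := by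
    refine (wasserstein_empirical_empirical_le hp _ _).trans ?_
    rw [mul_comm (ENNReal.ofReal ε), sampleNorm, ← rpow_mul_rpow_inv hp]
    refine ENNReal.rpow_le_rpow ?_ (by positivity)
    rw [mul_assoc, Finset.sum_mul]
    gcongr with i
    rw [mul_comm]
    exact h' (x i)
  have h2 : wasserstein p (μ.map (proj F)) (μ.map (proj E)) ≤
      ENNReal.ofReal ε * momentNorm p μ := by
    rw [wasserstein_comm]
    refine (wasserstein_map_map_le hp μ hE hF).trans ?_
    rw [mul_comm (ENNReal.ofReal ε), momentNorm, ← rpow_mul_rpow_inv hp]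
    refine ENNReal.rpow_le_rpow ?_ (by positivity)
    unfold absMoment
    rw [mul_comm, ← lintegral_const_mul _ (by fun_prop)]
    exact lintegral_mono h'
  rw [e]
  calc _ ≤ wasserstein p (empirical fun i => proj E (x i)) (empirical fun i => proj F (x i)) +
        wasserstein p (empirical fun i => proj F (x i)) (μ.map (proj E)) :=
        wasserstein_triangle hp _ _ _
    _ ≤ ENNReal.ofReal ε * sampleNorm p x +
        (wasserstein p (empirical fun i => proj F (x i)) (μ.map (proj F)) +
          ENNReal.ofReal ε * momentNorm p μ) :=
        add_le_add h1 ((wasserstein_triangle hp _ _ _).trans (add_le_add le_rfl h2))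
    _ = _ := by ring

/-- A maximal inequality from exponential moments. -/
theorem exp_maximal {ι : Type*} (T : Finset ι) (w : ι → ℝ) {i : ι} (hi : i ∈ T) {t : ℝ} (ht : 0 < t)
    (m a : ℝ) :
    w i ≤ (m + a / t) + Real.exp (-(t * m) - a) / t * ∑ j ∈ T, Real.exp (t * w j) := by
  -- Using `s ≤ exp s` in place of Jensen for the logarithm keeps the bound linear in the sum of
  -- exponentials, so it integrates termwise.
  have h1 : t * (w i - m) - a ≤ Real.exp (t * (w i - m) - a) := by
    linarith [Real.add_one_le_exp (t * (w i - m) - a)]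
  have h2 : Real.exp (t * (w i - m) - a) = Real.exp (-(t * m) - a) * Real.exp (t * w i) := by
    rw [← Real.exp_add]
    ring_nf
  have h3 : Real.exp (t * w i) ≤ ∑ j ∈ T, Real.exp (t * w j) :=
    Finset.single_le_sum (f := fun j => Real.exp (t * w j)) (fun j _ => Real.exp_nonneg _) hi
  have h4 : t * (w i - m) - a ≤ Real.exp (-(t * m) - a) * ∑ j ∈ T, Real.exp (t * w j) := by
    rw [h2] at h1
    exact h1.trans (by gcongr)
  have h5 : (t * (w i - m) - a) / t ≤
      (Real.exp (-(t * m) - a) * ∑ j ∈ T, Real.exp (t * w j)) / t := by gcongr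
  have h6 : (t * (w i - m) - a) / t = w i - m - a / t := by field_simp
  rw [h6, mul_div_right_comm] at h5
  linarith

/-- The uniform bound over a net, before optimization in `t`. -/
theorem lintegral_prw_empirical_le {d k n : ℕ} {p σ V t m A ε : ℝ} (hp : 1 ≤ p) (hn : 1 ≤ n)
    (hε : 0 < ε) (μ : Measure (EuclideanSpace ℝ (Fin d))) [IsProbabilityMeasure μ]
    (hfin : absMoment p μ ≠ ⊤) (hB : ProjBernsteinTail k σ V μ)
    (hA : (1 + 2 / ε) ^ (d * k) ≤ Real.exp A) (ht : 0 < t)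
    (htV : 4 * t * (n : ℝ) ^ (-(1 / p)) * V ≤ 1) (hA0 : 0 ≤ A) (hm0 : 0 ≤ m)
    (hm : ∀ E ∈ stiefel d k, ∫⁻ y, wasserstein p (empirical y) (μ.map (proj E))
      ∂(Measure.pi fun _ : Fin n => μ.map (proj E)) ≤ ENNReal.ofReal m) :
    ∫⁻ x, prw p k (empirical x) μ ∂(Measure.pi fun _ : Fin n => μ) ≤
      ENNReal.ofReal (m + (A + n * (4 * t ^ 2 * ((n : ℝ) ^ (-(1 / p))) ^ 2 * σ ^ 2) + 1) / t) +
        ENNReal.ofReal ε * (momentNorm p μ + momentNorm p μ) := by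
  obtain ⟨T, hT1, hT2, hT3⟩ := exists_stiefel_net d k hε
  have hT4 : (T.card : ℝ) ≤ Real.exp A := hT3.trans hA
  have hn0 : (0 : ℝ) < n := by exact_mod_cast hn
  set B : ℝ := n * (4 * t ^ 2 * ((n : ℝ) ^ (-(1 / p))) ^ 2 * σ ^ 2) with hBdef
  have hB0 : 0 ≤ B := by positivity
  have hprob : ∀ E : Matrix (Fin d) (Fin k) ℝ, IsProbabilityMeasure (μ.map (proj E)) := fun E =>
    Measure.isProbabilityMeasure_map (measurable_proj E).aemeasurable
  have hfinE : ∀ E ∈ stiefel d k, ∫⁻ y, ‖y‖ₑ ^ p ∂(μ.map (proj E)) ≠ ⊤ := fun E hE =>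
    lintegral_map_proj_ne_top hp hfin hE
  let w : Matrix (Fin d) (Fin k) ℝ → (Fin n → EuclideanSpace ℝ (Fin d)) → ℝ := fun E x =>
    sampleDist p (μ.map (proj E)) fun i => proj E (x i)
  have hpm : ∀ E : Matrix (Fin d) (Fin k) ℝ,
      Measurable fun (x : Fin n → EuclideanSpace ℝ (Fin d)) i => proj E (x i) := fun E =>
    measurable_pi_lambda _ fun i => (measurable_proj E).comp (measurable_pi_apply i)
  have hwm : ∀ E ∈ stiefel d k, Measurable (w E) := fun E hE =>
    (continuous_sampleDist hp hn (hfinE E hE)).measurable.comp (hpm E)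
  have hwexp : ∀ E ∈ stiefel d k,
      ∫⁻ x, ENNReal.ofReal (Real.exp (t * w E x)) ∂(Measure.pi fun _ : Fin n => μ) ≤
        ENNReal.ofReal (Real.exp (t * m + B)) := by
    intro E hE
    have h := lintegral_exp_sampleDist_le hp hn (hfinE E hE) (hB.bernsteinMoments hE) ht.le htV hm0
      (hm E hE)
    have hms := (continuous_sampleDist (n := n) hp hn (hfinE E hE)).measurable
    rwa [← Measure.pi_map_pi fun _ => (measurable_proj E).aemeasurable,
      lintegral_map (by fun_prop) (hpm E)] at h
  have hpt : ∀ x : Fin n → EuclideanSpace ℝ (Fin d), prw p k (empirical x) μ ≤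
      ENNReal.ofReal (m + (A + B) / t) + ENNReal.ofReal (Real.exp (-(t * m) - (A + B)) / t) *
        (∑ E ∈ T, ENNReal.ofReal (Real.exp (t * w E x))) +
        ENNReal.ofReal ε * (sampleNorm p x + momentNorm p μ) := by
    intro x
    refine iSup₂_le fun E hE => ?_
    obtain ⟨F, hF, hEF⟩ := hT2 E hE
    refine (wasserstein_proj_le hp hn hε.le μ hEF x).trans (add_le_add_left ?_ _)
    rw [← ENNReal.ofReal_toReal (wasserstein_empirical_ne_top hp hn (hfinE F (hT1 F hF)) _),
      ← ENNReal.ofReal_sum_of_nonneg fun _ _ => Real.exp_nonneg _,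
      ← ENNReal.ofReal_mul (by positivity), ← ENNReal.ofReal_add (by positivity) (by positivity)]
    exact ENNReal.ofReal_le_ofReal (exp_maximal T (fun E => w E x) hF ht m (A + B))
  have hsn := measurable_sampleNorm (d := d) (n := n) p
  have hsm : Measurable fun x => ∑ E ∈ T, ENNReal.ofReal (Real.exp (t * w E x)) :=
    Finset.measurable_fun_sum _ fun E hE => by
      have := hwm E (hT1 E hE)
      fun_prop
  refine (lintegral_mono hpt).trans ?_
  rw [lintegral_add_right _ (by fun_prop), lintegral_add_left measurable_const, lintegral_const,
    measure_univ, mul_one, lintegral_const_mul _ hsm, lintegral_const_mul _ (by fun_prop),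
    lintegral_add_left hsn, lintegral_const, measure_univ, mul_one]
  refine add_le_add ?_ (mul_le_mul_right (add_le_add_left (lintegral_sampleNorm_le hp hn μ) _) _)
  have hsum : ∫⁻ x, ∑ E ∈ T, ENNReal.ofReal (Real.exp (t * w E x)) ∂(Measure.pi fun _ => μ) ≤
      ENNReal.ofReal (Real.exp A * Real.exp (t * m + B)) := by
    rw [lintegral_finsetSum' _ fun E hE => by
      have := hwm E (hT1 E hE)
      fun_prop]
    refine (Finset.sum_le_sum fun E hE => hwexp E (hT1 E hE)).trans ?_
    rw [Finset.sum_const, nsmul_eq_mul, ENNReal.ofReal_mul (Real.exp_nonneg _)]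
    gcongr
    rw [← ENNReal.ofReal_natCast]
    exact ENNReal.ofReal_le_ofReal hT4
  refine (add_le_add_right (mul_le_mul_right hsum _) _).trans ?_
  rw [← ENNReal.ofReal_mul (by positivity), ← ENNReal.ofReal_add (by positivity) (by positivity)]
  refine ENNReal.ofReal_le_ofReal (le_of_eq ?_)
  -- The shift `a = A + B` was chosen to cancel the net cardinality and the variance term, leaving
  -- exactly `1 / t`.
  have e : Real.exp (-(t * m) - (A + B)) / t * (Real.exp A * Real.exp (t * m + B)) = 1 / t := by
    rw [div_mul_eq_mul_div, ← Real.exp_add, ← Real.exp_add]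
    have : -(t * m) - (A + B) + (A + (t * m + B)) = 0 := by ring
    rw [this, Real.exp_zero]
  rw [e]
  ring

/-- Choice of the parameter `t` in the exponential moments. -/
theorem exists_parameter {A N L σ V : ℝ} (hA : 1 ≤ A) (hN : 0 < N) (hL : 0 < L) (hσ : 0 < σ)
    (hV : 0 < V) :
    ∃ t : ℝ, 0 < t ∧ 4 * t * L * V ≤ 1 ∧
      (A + N * (4 * t ^ 2 * L ^ 2 * σ ^ 2) + 1) / t ≤
        6 * (L * σ * √(N * A)) + 8 * (L * V * A) := by
  have hA0 : 0 < A := by linarith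
  set s := √(N * A) with hs
  have hs0 : 0 < s := Real.sqrt_pos.2 (by positivity)
  have hss : s * s = N * A := Real.mul_self_sqrt (by positivity)
  -- `t₁` balances `A / t` against the quadratic term, `t₂` saturates the constraint. At the
  -- minimum, `A / t` is at most the sum of its two values, and `A ≥ 1` absorbs `1 / t`.
  set t₁ := s / (N * L * σ) with ht₁
  set t₂ := 1 / (4 * L * V) with ht₂
  have h1 : 0 < t₁ := by positivity
  have h2 : 0 < t₂ := by positivity
  have e1 : A / t₁ = L * σ * s := by
    rw [ht₁, div_div_eq_mul_div, div_eq_iff hs0.ne']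
    linear_combination -L * σ * hss
  have e2 : A / t₂ = 4 * (L * V * A) := by
    rw [ht₂]
    field_simp
  have e3 : N * (4 * t₁ * L ^ 2 * σ ^ 2) = 4 * (L * σ * s) := by
    rw [ht₁]
    field_simp
  refine ⟨min t₁ t₂, lt_min h1 h2, ?_, ?_⟩
  · calc 4 * min t₁ t₂ * L * V ≤ 4 * t₂ * L * V := by
          gcongr
          exact min_le_right _ _
      _ = 1 := by
          rw [ht₂]
          field_simp
  · set t := min t₁ t₂ with ht
    have ht0 : 0 < t := lt_min h1 h2
    have h3 : A / t ≤ A / t₁ + A / t₂ := by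
      have p1 : 0 < A / t₁ := by positivity
      have p2 : 0 < A / t₂ := by positivity
      rcases min_choice t₁ t₂ with h | h <;> rw [ht, h] <;> linarith
    have h4 : N * (4 * t * L ^ 2 * σ ^ 2) ≤ N * (4 * t₁ * L ^ 2 * σ ^ 2) := by
      gcongr
      exact min_le_left _ _
    have h5 : 1 / t ≤ A / t := by gcongr
    have e4 : (A + N * (4 * t ^ 2 * L ^ 2 * σ ^ 2) + 1) / t =
        A / t + N * (4 * t * L ^ 2 * σ ^ 2) + 1 / t := by
      field_simp
    rw [e4]
    linarith

/-! ### Assembly of the bound -/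

/-- `1 + 2 n ≤ n ^ 3` for `n ≥ 2`; the left side is the cardinality bound for a net of mesh `1 / n`.
-/
theorem one_add_two_mul_pow_le_exp {n : ℕ} (hn : 2 ≤ n) (N : ℕ) :
    (1 + 2 / (n : ℝ)⁻¹) ^ N ≤ Real.exp (3 * (N * Real.log n)) := by
  have hn2 : (2 : ℝ) ≤ n := by exact_mod_cast hn
  have h1 : 3 * (N * Real.log n) = N * Real.log ((n : ℝ) ^ 3) := by
    rw [Real.log_pow]
    push_cast
    ring
  rw [h1, mul_comm, Real.exp_mul, Real.exp_log (by positivity), Real.rpow_natCast, div_inv_eq_mul]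
  refine pow_le_pow_left₀ (by positivity) ?_ N
  nlinarith [mul_nonneg (sub_nonneg.2 hn2) (sub_nonneg.2 hn2), mul_self_nonneg ((n : ℝ) - 2)]

theorem momentNorm_eq_ofReal {d : ℕ} {q : ℝ} (hq0 : 0 < q) {μ : Measure (EuclideanSpace ℝ (Fin d))}
    (hq : absMoment q μ < ⊤) :
    momentNorm q μ = ENNReal.ofReal ((absMoment q μ).toReal ^ (1 / q)) := by
  rw [← ENNReal.ofReal_rpow_of_nonneg ENNReal.toReal_nonneg (by positivity),
    ENNReal.ofReal_toReal hq.ne]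
  rfl

theorem absMoment_ne_top {d : ℕ} {p q : ℝ} (hp : 1 ≤ p) (hpq : p ≤ q)
    {μ : Measure (EuclideanSpace ℝ (Fin d))} [IsProbabilityMeasure μ] (hq : absMoment q μ < ⊤) :
    absMoment p μ ≠ ⊤ := by
  intro h
  have h1 := (momentNorm_mono hp hpq μ).trans_eq (momentNorm_eq_ofReal (by linarith) hq)
  rw [momentNorm, h, ENNReal.top_rpow_of_pos (by positivity), top_le_iff] at h1
  exact ENNReal.ofReal_ne_top h1

/-- The bound for a product measure and `n ≥ 2`. -/
theorem exists_lintegral_prw_le {p q : ℝ} (hp : 1 ≤ p) (hpq : p ≤ q) :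
    ∃ C : ℝ, 0 < C ∧ ∀ (d k : ℕ), 1 ≤ k → k ≤ d →
      ∀ (μ : Measure (EuclideanSpace ℝ (Fin d))) [IsProbabilityMeasure μ], absMoment q μ < ⊤ →
      ∀ (σ V : ℝ), ProjBernsteinTail k σ V μ → ∀ n : ℕ, 2 ≤ n →
        ∫⁻ x, prw p k (empirical x) μ ∂(Measure.pi fun _ : Fin n => μ) ≤
          ENNReal.ofReal (C * ((absMoment q μ).toReal ^ (1 / q) + σ + V) *
            (iprwRate p q k n + (n : ℝ) ^ (1 / 2 - 1 / p) * √(d * k * Real.log n) +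
              (n : ℝ) ^ (-(1 / p)) * (d * k * Real.log n))) := by
  obtain ⟨C₁, hC₁, H₁⟩ := exists_mean_bound hp
  obtain ⟨C₂, hC₂, H₂⟩ := exists_le_iprwRate hp hpq
  -- `32` dominates the coefficients `12`, `24` and `8` of `σ * S`, `V * U` and `M * I` below.
  refine ⟨C₁ * C₂ + 32, by positivity, fun d k hk hkd μ _ hq σ V hB n hn => ?_⟩
  have hσ := hB.sigma_pos
  have hV := hB.V_pos
  have hn0 : (0 : ℝ) < n := by exact_mod_cast (by omega : 0 < n)
  have hlog : 1 ≤ 3 * Real.log n := by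
    have h1 := Real.log_two_gt_d9
    have h2 := Real.log_le_log (by norm_num) (by exact_mod_cast hn : (2 : ℝ) ≤ n)
    linarith
  set D : ℝ := d * k * Real.log n with hD
  have hdk : (1 : ℝ) ≤ d * k := by
    exact_mod_cast Nat.one_le_iff_ne_zero.2 (Nat.mul_ne_zero (by omega) (by omega))
  have hD1 : 1 ≤ 3 * D := by
    rw [hD]
    nlinarith
  set M : ℝ := (absMoment q μ).toReal ^ (1 / q) with hM
  have hM0 : 0 ≤ M := by positivity
  have hMp : momentNorm p μ ≤ ENNReal.ofReal M :=
    (momentNorm_mono hp hpq μ).trans_eq (momentNorm_eq_ofReal (by linarith) hq)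
  have hfin : absMoment p μ ≠ ⊤ := absMoment_ne_top hp hpq hq
  set I := iprwRate p q k n with hI
  have hI1 : (n : ℝ)⁻¹ ≤ 4 * I := inv_le_iprwRate hp hn
  have hI0 : 0 ≤ I := by
    have : 0 < (n : ℝ)⁻¹ := by positivity
    linarith
  set m : ℝ := C₁ * (σ + V) * (C₂ * I) with hm
  have hmean : ∀ E ∈ stiefel d k, ∫⁻ y, wasserstein p (empirical y) (μ.map (proj E))
      ∂(Measure.pi fun _ : Fin n => μ.map (proj E)) ≤ ENNReal.ofReal m := by
    intro E hE
    have : IsProbabilityMeasure (μ.map (proj E)) :=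
      Measure.isProbabilityMeasure_map (measurable_proj E).aemeasurable
    refine (H₁ k n hn (σ + V) (by positivity) (μ.map (proj E))
      fun r hr => hB.moment_le_pow hE hr).trans (ENNReal.ofReal_le_ofReal ?_)
    exact mul_le_mul_of_nonneg_left (H₂ k n hn) (by positivity)
  obtain ⟨t, ht, htV, htle⟩ := exists_parameter hD1 hn0
    (by positivity : 0 < (n : ℝ) ^ (-(1 / p))) hσ hV
  have hA := one_add_two_mul_pow_le_exp hn (d * k)
  rw [Nat.cast_mul, ← hD] at hA
  refine (lintegral_prw_empirical_le hp (by omega) (inv_pos.2 hn0) μ hfin hB hA ht htV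
    (by linarith) (by positivity) hmean).trans ?_
  -- The net error: the mesh `1 / n` is at most four times the rate.
  have hfirst : ENNReal.ofReal (n : ℝ)⁻¹ * (momentNorm p μ + momentNorm p μ) ≤
      ENNReal.ofReal (4 * I * (M + M)) := by
    rw [ENNReal.ofReal_mul (by positivity), ENNReal.ofReal_add hM0 hM0]
    gcongr
  refine (add_le_add_right hfirst _).trans ?_
  rw [← ENNReal.ofReal_add (by positivity) (by positivity)]
  refine ENNReal.ofReal_le_ofReal ?_
  have hsqrt : (n : ℝ) ^ (-(1 / p)) * σ * √(n * (3 * D)) ≤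
      2 * (σ * ((n : ℝ) ^ (1 / 2 - 1 / p) * √D)) := by
    have e1 : (n : ℝ) ^ (1 / 2 - 1 / p) = (n : ℝ) ^ (-(1 / p)) * √n := by
      rw [Real.sqrt_eq_rpow, ← Real.rpow_add hn0]
      congr 1
      ring
    have e2 : √(n * (3 * D)) ≤ √n * (2 * √D) := by
      rw [Real.sqrt_mul hn0.le, Real.sqrt_mul (by norm_num : (0 : ℝ) ≤ 3)]
      gcongr
      exact (Real.sqrt_le_left (by norm_num)).2 (by norm_num)
    rw [e1]
    calc _ ≤ (n : ℝ) ^ (-(1 / p)) * σ * (√n * (2 * √D)) := by gcongr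
      _ = _ := by ring
  set S := (n : ℝ) ^ (1 / 2 - 1 / p) * √D with hS
  set U := (n : ℝ) ^ (-(1 / p)) * D with hU
  have hS0 : 0 ≤ S := by positivity
  have hU0 : 0 ≤ U := mul_nonneg (by positivity) (by linarith)
  have e3 : (n : ℝ) ^ (-(1 / p)) * V * (3 * D) = 3 * (V * U) := by
    rw [hU]
    ring
  rw [e3] at htle
  have hVS : 0 ≤ V * S := by positivity
  have hVU : 0 ≤ V * U := by positivity
  have hVI : 0 ≤ V * I := by positivity
  have hσS : 0 ≤ σ * S := by positivity
  have hσU : 0 ≤ σ * U := by positivity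
  have hσI : 0 ≤ σ * I := by positivity
  have hMS : 0 ≤ M * S := by positivity
  have hMU : 0 ≤ M * U := by positivity
  have hMI : 0 ≤ M * I := by positivity
  have hC : 0 ≤ C₁ * C₂ * ((M + σ + V) * (I + S + U) - (σ + V) * I) := by
    refine mul_nonneg (by positivity) ?_
    linarith
  calc m + _ + 4 * I * (M + M) ≤
        m + (6 * (2 * (σ * S)) + 8 * (3 * (V * U))) + 4 * I * (M + M) := by linarith
    _ ≤ _ := by
      rw [hm]
      linarith

/-- The bound for a sample of size `1`. -/
theorem lintegral_prw_one_le {d k : ℕ} {p q : ℝ} (hp : 1 ≤ p) (hpq : p ≤ q)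
    (μ : Measure (EuclideanSpace ℝ (Fin d))) [IsProbabilityMeasure μ] (hq : absMoment q μ < ⊤) :
    ∫⁻ x, prw p k (empirical x) μ ∂(Measure.pi fun _ : Fin 1 => μ) ≤
      ENNReal.ofReal (2 * (absMoment q μ).toReal ^ (1 / q)) := by
  have hMp := (momentNorm_mono hp hpq μ).trans_eq (momentNorm_eq_ofReal (by linarith) hq)
  -- No net is needed for a single point: comparison with the Dirac mass at `0` bounds all
  -- projections at once.
  refine (lintegral_mono fun x => prw_empirical_le hp le_rfl μ x).trans ?_
  rw [lintegral_add_right _ measurable_const, lintegral_const, measure_univ, mul_one, two_mul,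
    ENNReal.ofReal_add (by positivity) (by positivity)]
  exact add_le_add ((lintegral_sampleNorm_le hp le_rfl μ).trans hMp) hMp

end PRW

end

theorem mainTheorem3 (p q : ℝ) (hp : 1 ≤ p) (hpq : p ≤ q) :
    ∃ C : ℝ, 0 < C ∧
      ∀ (d k : ℕ), 1 ≤ k → k ≤ d →
      ∀ (μ : Measure (EuclideanSpace ℝ (Fin d))) [IsProbabilityMeasure μ],
        PRW.absMoment q μ < ⊤ →
      ∀ (σ V : ℝ), PRW.ProjBernsteinTail k σ V μ →
      ∀ (n : ℕ), 1 ≤ n → (n = 1 → PRW.zeta p q k = 0) →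
      ∀ (Ω : Type*) [MeasurableSpace Ω] (P : Measure Ω) [IsProbabilityMeasure P]
        (X : Fin n → Ω → EuclideanSpace ℝ (Fin d)),
        (∀ i, HasLaw (X i) μ P) → iIndepFun X P →
        ∫⁻ ω, PRW.prw p k (PRW.empirical fun i => X i ω) μ ∂P ≤
          ENNReal.ofReal (C * ((PRW.absMoment q μ).toReal ^ (1 / q) + σ + V) *
            (PRW.iprwRate p q k n
              + (n : ℝ) ^ (1 / 2 - 1 / p) * Real.sqrt (d * k * Real.log n)
              + (n : ℝ) ^ (-(1 / p)) * (d * k * Real.log n))) := by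
  obtain ⟨C, hC, H⟩ := PRW.exists_lintegral_prw_le hp hpq
  refine ⟨C + 2, by positivity, fun d k hk hkd μ _ hq σ V hB n hn hn1 Ω _ P _ X hX hind => ?_⟩
  have hσ := hB.sigma_pos
  have hV := hB.V_pos
  have hXm : ∀ i, AEMeasurable (X i) P := fun i => (hX i).aemeasurable
  have hlaw : P.map (fun ω i => X i ω) = Measure.pi fun _ : Fin n => μ := by
    rw [(iIndepFun_iff_map_fun_eq_pi_map hXm).1 hind]
    simp_rw [(hX _).map_eq]
  have hmeas := PRW.measurable_prw_empirical (k := k) hp hn μ (PRW.absMoment_ne_top hp hpq hq)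
  have hpush : ∫⁻ ω, PRW.prw p k (PRW.empirical fun i => X i ω) μ ∂P =
      ∫⁻ x, PRW.prw p k (PRW.empirical x) μ ∂(Measure.pi fun _ : Fin n => μ) := by
    rw [← hlaw, lintegral_map' hmeas.aemeasurable (aemeasurable_pi_lambda _ hXm)]
  rw [hpush]
  have hlog := Real.log_natCast_nonneg n
  rcases hn.eq_or_lt with rfl | hn2
  · refine (PRW.lintegral_prw_one_le hp hpq μ hq).trans (ENNReal.ofReal_le_ofReal ?_)
    have hM : 0 ≤ (PRW.absMoment q μ).toReal ^ (1 / q) := by positivity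
    -- `ζ = 0` makes the logarithmic factor `0 ^ 0 = 1`; with `ζ > 0` the whole right-hand side
    -- would vanish at `n = 1`.
    have hI : PRW.iprwRate p q k 1 = 1 := by
      simp [PRW.iprwRate, hn1 rfl]
    rw [hI]
    simp only [Nat.cast_one, Real.log_one, mul_zero, Real.sqrt_zero, add_zero, mul_one]
    nlinarith
  · refine (H d k hk hkd μ hq σ V hB n hn2).trans (ENNReal.ofReal_le_ofReal ?_)
    have hI : 0 ≤ PRW.iprwRate p q k n := by
      unfold PRW.iprwRate
      positivity
    gcongr
    linarith
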